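/- **Conventions.** Let $A$ be a complex Banach algebra, not necessarily unital, and let $X$ be a Banach $A$-bimodule (a Banach space with commuting, jointly bounded left and right actions of $A$). Let $C^n(A,X)$ be the Banach space of bounded $n$-linear maps $A\times\dots\times A\to X$, with $C^0(A,X)=X$, and define $\delta^n: C^n(A,X)\to C^{n+1}(A,X)$ by $$(\delta^n f)(a_1,\dots,a_{n+1})=a_1\cdot f(a_2,\dots,a_{n+1})+\sum_{i=1}^n(-1)^i f(a_1,\dots,a_ia_{i+1},\dots,a_{n+1})+(-1)^{n+1}f(a_1,\dots,a_n)\cdot a_{n+1}.$$ Let $\mathcal H^n(A,X)=\ker\delta^n/\operatorname{im}\delta^{n-1}$ (with $\operatorname{im}\delta^{-1}=0$), with the quotient seminorm. The dual $X^*$ is a Banach $A$-bimodule with $(a\cdot f)(x)=f(x\cdot a)$ and $(f\cdot a)(x)=f(a\cdot x)$. The algebra $A$ is *amenable* if $\mathcal H^1(A,X^*)=0$ for every Banach $A$-bimodule $X$. For a Banach $A$-bimodule $X$ write $\operatorname{Cen}_A X=\{x\in X: a\cdot x=x\cdot a\text{ for all }a\in A\}$. For a closed two-sided ideal $I$ of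 $A$ with quotient map $\theta:A\to A/I$, the *natural map* $\mathcal H^n(A/I,(A/I)^*)\to\mathcal H^n(A,A^*)$ sends the class of $f$ to the class of $(a_1,\dots,a_n)\mapsto f(\theta(a_1),\dots,\theta(a_n))\circ\theta$. **Theorem 2.4.** Let $A$ be a Banach algebra and let $I$ be a closed two-sided ideal of $A$ which is an amenable Banach algebra. Then (i) for all $n\ge 2$ the natural map $\mathcal H^n(A/I,(A/I)^*)\to\mathcal H^n(A,A^*)$ is a topological isomorphism of seminormed spaces, and for $n=1$ the natural map $\mathcal H^1(A/I,(A/I)^*)\to\mathcal H^1(A,A^*)$ is surjective; (ii) if $\operatorname{Cen}_I I^*=\{0\}$ (that is, $I$ has no non-zero bounded trace), then for all $n\ge 0$ the natural map $\mathcal H^n(A/I,(A/I)^*)\to\mathcal H^n(A,A^*)$ is a topological isomorphism of seminormed spaces. -/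

import Mathlib

noncomputable section

open scoped Topology

universe u v w

namespace BanachCohomology

/-! ### Banach bimodules -/

/-- A Banach bimodule structure of the (not necessarily unital) Banach algebra `A` on the Banach
space `X`: commuting left and right actions `a · x = left a x` and `x · a = right a x`
which are jointly bounded bilinear maps. -/
structure Bimodule (A : Type u) [NonUnitalNormedRing A] [NormedSpace ℂ A]
    (X : Type v) [NormedAddCommGroup X] [NormedSpace ℂ X] where
  left : A →L[ℂ] X →L[ℂ] X
  right : A →L[ℂ] X →L[ℂ] X
  left_mul : ∀ a b x, left (a * b) x = left a (left b x)
  right_mul : ∀ a b x, right (a * b) x = right b (right a x)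
  left_right : ∀ a b x, left a (right b x) = right b (left a x)

namespace Bimodule

variable {A : Type u} [NonUnitalNormedRing A] [NormedSpace ℂ A]
  {X : Type v} [NormedAddCommGroup X] [NormedSpace ℂ X]

/-- The dual bimodule `X*`: `(a · f)(x) = f (x · a)` and `(f · a)(x) = f (a · x)`. -/
def dual (M : Bimodule A X) : Bimodule A (StrongDual ℂ X) where
  left := (ContinuousLinearMap.compL ℂ X X ℂ).flip.comp M.right
  right := (ContinuousLinearMap.compL ℂ X X ℂ).flip.comp M.left
  left_mul a b f := by ext x; simp [M.right_mul]
  right_mul a b f := by ext x; simp [M.left_mul]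
  left_right a b f := by ext x; simp [M.left_right]

@[simp] lemma dual_left_apply (M : Bimodule A X) (a : A) (f : StrongDual ℂ X) (x : X) :
    M.dual.left a f x = f (M.right a x) := rfl

@[simp] lemma dual_right_apply (M : Bimodule A X) (a : A) (f : StrongDual ℂ X) (x : X) :
    M.dual.right a f x = f (M.left a x) := rfl

/-- The centre `Cen_A X = {x : a · x = x · a for all a ∈ A}`. -/
def center (M : Bimodule A X) : Submodule ℂ X where
  carrier := {x | ∀ a, M.left a x = M.right a x}
  add_mem' hx hy a := by simp [hx a, hy a]
  zero_mem' a := by simp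
  smul_mem' c x hx a := by simp [hx a]

/-- `A` as a bimodule over itself. -/
def regular (A : Type u) [NonUnitalNormedRing A] [NormedSpace ℂ A]
    [IsScalarTower ℂ A A] [SMulCommClass ℂ A A] : Bimodule A A where
  left := ContinuousLinearMap.mul ℂ A
  right := (ContinuousLinearMap.mul ℂ A).flip
  left_mul a b x := by simp [mul_assoc]
  right_mul a b x := by simp [mul_assoc]
  left_right a b x := by simp [mul_assoc]

@[simp] lemma regular_left_apply [IsScalarTower ℂ A A] [SMulCommClass ℂ A A] (a x : A) :
    (regular A).left a x = a * x := rfl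

@[simp] lemma regular_right_apply [IsScalarTower ℂ A A] [SMulCommClass ℂ A A] (a x : A) :
    (regular A).right a x = x * a := rfl

end Bimodule

/-! ### The standard cohomological complex -/

/-- The Banach space `Cⁿ(A, X)` of bounded `n`-linear maps `A × ⋯ × A → X`
(for `n = 0` this is `X`, an element `x` being the map `() ↦ x`). -/
abbrev Cochain (A : Type u) [NonUnitalNormedRing A] [NormedSpace ℂ A]
    (X : Type v) [NormedAddCommGroup X] [NormedSpace ℂ X] (n : ℕ) : Type (max u v) :=
  ContinuousMultilinearMap ℂ (fun _ : Fin n => A) X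

section Coboundary

variable {A : Type u} [NonUnitalNormedRing A] [NormedSpace ℂ A]
  {X : Type v} [NormedAddCommGroup X] [NormedSpace ℂ X]

/-- The cochain `(a₀, …, aₙ) ↦ a₀ · f (a₁, …, aₙ)`. -/
def leftTerm (M : Bimodule A X) {n : ℕ} (f : Cochain A X n) : Cochain A X (n + 1) where
  toFun a := M.left (a 0) (f (Fin.tail a))
  map_update_add' {inst} m j x y := by
    rw [Subsingleton.elim inst (instDecidableEqFin (n + 1))]
    refine Fin.cases ?_ (fun j => ?_) j
    · simp
    · simp [(Fin.succ_ne_zero j).symm]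
  map_update_smul' {inst} m j c x := by
    rw [Subsingleton.elim inst (instDecidableEqFin (n + 1))]
    refine Fin.cases ?_ (fun j => ?_) j
    · simp
    · simp [(Fin.succ_ne_zero j).symm]
  cont := by
    have h : Continuous fun a : Fin (n + 1) → A => f (Fin.tail a) :=
      f.cont.comp (continuous_pi fun k => continuous_apply k.succ)
    exact (M.left.continuous.comp (continuous_apply 0)).clm_apply h

@[simp] lemma leftTerm_apply (M : Bimodule A X) {n : ℕ} (f : Cochain A X n)
    (a : Fin (n + 1) → A) : leftTerm M f a = M.left (a 0) (f (Fin.tail a)) := rfl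

/-- The cochain `(a₀, …, aₙ) ↦ f (a₀, …, aₙ₋₁) · aₙ`. -/
def rightTerm (M : Bimodule A X) {n : ℕ} (f : Cochain A X n) : Cochain A X (n + 1) where
  toFun a := M.right (a (Fin.last n)) (f (Fin.init a))
  map_update_add' {inst} m j x y := by
    rw [Subsingleton.elim inst (instDecidableEqFin (n + 1))]
    refine Fin.lastCases ?_ (fun j => ?_) j
    · simp
    · simp [(Fin.castSucc_lt_last j).ne']
  map_update_smul' {inst} m j c x := by
    rw [Subsingleton.elim inst (instDecidableEqFin (n + 1))]
    refine Fin.lastCases ?_ (fun j => ?_) j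
    · simp
    · simp [(Fin.castSucc_lt_last j).ne']
  cont := by
    have h : Continuous fun a : Fin (n + 1) → A => f (Fin.init a) :=
      f.cont.comp (continuous_pi fun k => continuous_apply k.castSucc)
    exact (M.right.continuous.comp (continuous_apply (Fin.last n))).clm_apply h

@[simp] lemma rightTerm_apply (M : Bimodule A X) {n : ℕ} (f : Cochain A X n)
    (a : Fin (n + 1) → A) :
    rightTerm M f a = M.right (a (Fin.last n)) (f (Fin.init a)) := rfl

variable [IsScalarTower ℂ A A] [SMulCommClass ℂ A A]

lemma contractNth_update (n : ℕ) (i : Fin n) (m : Fin (n + 1) → A) (j : Fin (n + 1)) :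
    ∃ (k : Fin n) (L : A →ₗ[ℂ] A), ∀ x : A,
      Fin.contractNth i.castSucc (· * ·) (Function.update m j x) =
        Function.update (Fin.contractNth i.castSucc (· * ·) m) k (L x) := by
  have key : ∀ (l : Fin n) (x : A), l.castSucc ≠ j → l.succ ≠ j →
      Fin.contractNth i.castSucc (· * ·) (Function.update m j x) l =
        Fin.contractNth i.castSucc (· * ·) m l := by
    intro l x h1 h2
    simp [Fin.contractNth, Function.update_of_ne h1, Function.update_of_ne h2]
  rcases lt_trichotomy (j : ℕ) (i : ℕ) with h | h | h
  · refine ⟨⟨j, by omega⟩, LinearMap.id, fun x => funext fun l => ?_⟩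
    by_cases hl : l = ⟨j, by omega⟩
    · have : l.castSucc = j := by ext; simp [hl]
      subst hl
      simp only [Function.update_self]
      rw [Fin.contractNth_apply_of_lt _ _ _ _ (by simpa using h), this]
      simp
    · rw [Function.update_of_ne hl]
      have h1 : l.castSucc ≠ j := fun e => hl (by ext; simp [← e])
      by_cases h2 : l.succ = j
      · have hv : (l : ℕ) + 1 = j := by simp [← h2]
        rw [Fin.contractNth_apply_of_lt _ _ _ _ (by simp; omega),
          Fin.contractNth_apply_of_lt _ _ _ _ (by simp; omega), Function.update_of_ne h1]
      · exact key l x h1 h2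
  · refine ⟨i, LinearMap.mulRight ℂ (m i.succ), fun x => funext fun l => ?_⟩
    have hj : i.castSucc = j := by ext; simp [h]
    subst hj
    by_cases hl : l = i
    · subst hl
      simp only [Function.update_self]
      rw [Fin.contractNth_apply_of_eq _ _ _ _ (by simp)]
      simp [Function.update_of_ne (Fin.castSucc_lt_succ (i := l)).ne']
    · rw [Function.update_of_ne hl]
      have h1 : l.castSucc ≠ i.castSucc := fun e => hl (by simpa using e)
      by_cases h2 : l.succ = i.castSucc
      · have hv : (l : ℕ) + 1 = i := by simpa using congrArg Fin.val h2
        rw [Fin.contractNth_apply_of_lt _ _ _ _ (by simp; omega),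
          Fin.contractNth_apply_of_lt _ _ _ _ (by simp; omega), Function.update_of_ne h1]
      · exact key l x h1 h2
  · by_cases hi : (j : ℕ) = i + 1
    · refine ⟨i, LinearMap.mulLeft ℂ (m i.castSucc), fun x => funext fun l => ?_⟩
      have hj : i.succ = j := by ext; simp [hi]
      subst hj
      by_cases hl : l = i
      · subst hl
        simp only [Function.update_self]
        rw [Fin.contractNth_apply_of_eq _ _ _ _ (by simp)]
        simp [Function.update_of_ne (Fin.castSucc_lt_succ (i := l)).ne]
      · rw [Function.update_of_ne hl]
        have h2 : l.succ ≠ i.succ := fun e => hl (by simpa using e)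
        by_cases h1 : l.castSucc = i.succ
        · have hv : (l : ℕ) = i + 1 := by simpa using congrArg Fin.val h1
          rw [Fin.contractNth_apply_of_gt _ _ _ _ (by simp; omega),
            Fin.contractNth_apply_of_gt _ _ _ _ (by simp; omega), Function.update_of_ne h2]
        · exact key l x h1 h2
    · refine ⟨⟨j - 1, by omega⟩, LinearMap.id, fun x => funext fun l => ?_⟩
      by_cases hl : l = ⟨j - 1, by omega⟩
      · have hv : (l : ℕ) = j - 1 := by simp [hl]
        have h2 : l.succ = j := by ext; simp; omega
        rw [← hl, Function.update_self,
          Fin.contractNth_apply_of_gt _ _ _ _ (by simp; omega), h2]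
        simp
      · rw [Function.update_of_ne hl]
        have h2 : l.succ ≠ j := fun e => hl (by ext; simp [← e])
        by_cases h1 : l.castSucc = j
        · have hv : (l : ℕ) = j := by simpa using congrArg Fin.val h1
          rw [Fin.contractNth_apply_of_gt _ _ _ _ (by simp; omega),
            Fin.contractNth_apply_of_gt _ _ _ _ (by simp; omega), Function.update_of_ne h2]
        · exact key l x h1 h2

/-- For `i = 0, …, n - 1`, the cochain
`(a₀, …, aₙ) ↦ f (a₀, …, aᵢ aᵢ₊₁, …, aₙ)`. -/
def contract {n : ℕ} (i : Fin n) (f : Cochain A X n) : Cochain A X (n + 1) where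
  toFun a := f (Fin.contractNth i.castSucc (· * ·) a)
  map_update_add' {inst} m j x y := by
    rw [Subsingleton.elim inst (instDecidableEqFin (n + 1))]
    obtain ⟨k, L, h⟩ := contractNth_update n i m j
    simp only [h, map_add, ContinuousMultilinearMap.map_update_add]
  map_update_smul' {inst} m j c x := by
    rw [Subsingleton.elim inst (instDecidableEqFin (n + 1))]
    obtain ⟨k, L, h⟩ := contractNth_update n i m j
    simp only [h, map_smul, ContinuousMultilinearMap.map_update_smul]
  cont := by
    refine f.cont.comp (continuous_pi fun k => ?_)
    unfold Fin.contractNth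
    split_ifs <;> fun_prop

@[simp] lemma contract_apply {n : ℕ} (i : Fin n) (f : Cochain A X n) (a : Fin (n + 1) → A) :
    contract i f a = f (Fin.contractNth i.castSucc (· * ·) a) := rfl

/-- The coboundary operator `δⁿ : Cⁿ(A, X) → Cⁿ⁺¹(A, X)`; with arguments numbered from `0`,
`(δⁿ f)(a₀, …, aₙ) = a₀ · f(a₁, …, aₙ) + ∑_{i < n} (-1)^(i+1) f(a₀, …, aᵢ aᵢ₊₁, …, aₙ)
  + (-1)^(n+1) f(a₀, …, aₙ₋₁) · aₙ`. -/
def coboundary (M : Bimodule A X) (n : ℕ) : Cochain A X n →ₗ[ℂ] Cochain A X (n + 1) where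
  toFun f := leftTerm M f + ∑ i : Fin n, (-1 : ℂ) ^ ((i : ℕ) + 1) • contract i f
    + (-1 : ℂ) ^ (n + 1) • rightTerm M f
  map_add' f g := by
    ext a
    simp [Finset.sum_add_distrib]
    abel
  map_smul' c f := by
    ext a
    simp [Finset.smul_sum, smul_comm c]

lemma coboundary_apply (M : Bimodule A X) (n : ℕ) (f : Cochain A X n) (a : Fin (n + 1) → A) :
    coboundary M n f a = M.left (a 0) (f (Fin.tail a))
      + ∑ i : Fin n, (-1 : ℂ) ^ ((i : ℕ) + 1) • f (Fin.contractNth i.castSucc (· * ·) a)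
      + (-1 : ℂ) ^ (n + 1) • M.right (a (Fin.last n)) (f (Fin.init a)) := by
  simp [coboundary]

/-- The `n`-cocycles `Zⁿ(A, X) = ker δⁿ`. -/
def cocycles (M : Bimodule A X) (n : ℕ) : Submodule ℂ (Cochain A X n) :=
  LinearMap.ker (coboundary M n)

/-- The `n`-coboundaries: `N⁰(A, X) = 0` and `Nⁿ⁺¹(A, X) = im δⁿ`. -/
def coboundaries (M : Bimodule A X) : (n : ℕ) → Submodule ℂ (Cochain A X n)
  | 0 => ⊥
  | n + 1 => LinearMap.range (coboundary M n)

/-- The Banach cohomology group `Hⁿ(A, X) = Zⁿ(A, X) / Nⁿ(A, X)`, with its quotient seminorm. -/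
abbrev Cohomology (M : Bimodule A X) (n : ℕ) : Type (max u v) :=
  cocycles M n ⧸ (coboundaries M n).submoduleOf (cocycles M n)

end Coboundary

/-- The Banach algebra `A` is amenable: `H¹(A, X*) = 0` for every Banach `A`-bimodule `X`.
It is enough to test bimodules in the universe of `A`: a bounded approximate identity and a virtual
diagonal are obtained from bimodules built from `A` by projective tensor products and duals. -/
def IsAmenable (A : Type u) [NonUnitalNormedRing A] [NormedSpace ℂ A]
    [IsScalarTower ℂ A A] [SMulCommClass ℂ A A] : Prop :=
  ∀ (X : Type u) [NormedAddCommGroup X] [NormedSpace ℂ X] [CompleteSpace X]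
    (M : Bimodule A X), Subsingleton (Cohomology M.dual 1)

/-! ### Functoriality -/

section Pullback

variable {A : Type u} [NonUnitalNormedRing A] [NormedSpace ℂ A]
  {B : Type v} [NonUnitalNormedRing B] [NormedSpace ℂ B]
  {X : Type w} [NormedAddCommGroup X] [NormedSpace ℂ X]
  {Y : Type*} [NormedAddCommGroup Y] [NormedSpace ℂ Y]

/-- The map `Cⁿ(B, X) → Cⁿ(A, Y)`, `f ↦ ((a₁, …, aₙ) ↦ T (f (θ a₁, …, θ aₙ)))`. -/
def pullback (θ : A →L[ℂ] B) (T : X →L[ℂ] Y) (n : ℕ) : Cochain B X n →ₗ[ℂ] Cochain A Y n where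
  toFun f := T.compContinuousMultilinearMap (f.compContinuousLinearMap fun _ => θ)
  map_add' f g := by ext a; simp
  map_smul' c f := by ext a; simp

@[simp] lemma pullback_apply (θ : A →L[ℂ] B) (T : X →L[ℂ] Y) (n : ℕ) (f : Cochain B X n)
    (a : Fin n → A) : pullback θ T n f a = T (f (fun i => θ (a i))) := rfl

variable [IsScalarTower ℂ A A] [SMulCommClass ℂ A A]
  [IsScalarTower ℂ B B] [SMulCommClass ℂ B B]

lemma pullback_coboundary (θ : A →L[ℂ] B) (T : X →L[ℂ] Y)
    (MB : Bimodule B X) (MA : Bimodule A Y)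
    (hθ : ∀ a b, θ (a * b) = θ a * θ b)
    (hl : ∀ a x, T (MB.left (θ a) x) = MA.left a (T x))
    (hr : ∀ a x, T (MB.right (θ a) x) = MA.right a (T x)) (n : ℕ) (f : Cochain B X n) :
    pullback θ T (n + 1) (coboundary MB n f) = coboundary MA n (pullback θ T n f) := by
  ext a
  have hc : ∀ i : Fin n, Fin.contractNth i.castSucc (· * ·) (fun k => θ (a k)) =
      fun k => θ (Fin.contractNth i.castSucc (· * ·) a k) := fun i =>
    (Fin.comp_contractNth (· * ·) (· * ·) (f := θ) hθ i.castSucc a).symm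
  simp only [pullback_apply, coboundary_apply, map_add, map_sum, map_smul, hl, hr, hc]
  rfl

/-- The map `Hⁿ(B, X) → Hⁿ(A, Y)` induced by a homomorphism `θ : A → B` and a bounded operator
`T : X → Y` which intertwines the actions along `θ`. -/
def cohomologyMap (θ : A →L[ℂ] B) (T : X →L[ℂ] Y)
    (MB : Bimodule B X) (MA : Bimodule A Y)
    (hθ : ∀ a b, θ (a * b) = θ a * θ b)
    (hl : ∀ a x, T (MB.left (θ a) x) = MA.left a (T x))
    (hr : ∀ a x, T (MB.right (θ a) x) = MA.right a (T x)) (n : ℕ) :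
    Cohomology MB n →ₗ[ℂ] Cohomology MA n :=
  Submodule.mapQ _ _
    ((pullback θ T n).restrict (p := cocycles MB n) (q := cocycles MA n) fun f hf => by
      have hf' : coboundary MB n f = 0 := hf
      change coboundary MA n _ = 0
      rw [← pullback_coboundary θ T MB MA hθ hl hr, hf', map_zero])
    (by
      rintro ⟨f, hf⟩ hfN
      change pullback θ T n f ∈ coboundaries MA n
      replace hfN : f ∈ coboundaries MB n := hfN
      cases n with
      | zero =>
        have h0 : f = 0 := hfN
        rw [h0, map_zero]
        exact Submodule.zero_mem _
      | succ n =>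
        obtain ⟨g, rfl⟩ := hfN
        exact ⟨pullback θ T n g, (pullback_coboundary θ T MB MA hθ hl hr n g).symm⟩)

end Pullback

/-! ### Closed ideals and quotient algebras -/

/-- A closed two-sided ideal of a (not necessarily unital) Banach algebra. -/
structure ClosedIdeal (A : Type u) [NonUnitalNormedRing A] [NormedSpace ℂ A] extends
    Submodule ℂ A where
  mul_mem_left' : ∀ a x, x ∈ carrier → a * x ∈ carrier
  mul_mem_right' : ∀ x a, x ∈ carrier → x * a ∈ carrier
  isClosed' : IsClosed carrier

namespace ClosedIdeal

variable {A : Type u} [NonUnitalNormedRing A] [NormedSpace ℂ A]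

/-- The ideal as a closed subalgebra. -/
def toSubalgebra (I : ClosedIdeal A) : NonUnitalSubalgebra ℂ A where
  carrier := I.carrier
  add_mem' := I.add_mem'
  zero_mem' := I.zero_mem'
  mul_mem' {x y} _ hy := I.mul_mem_left' x y hy
  smul_mem' := I.smul_mem'

/-- The ideal as a Banach algebra, with the algebra operations and the norm of `A`. -/
abbrev Alg (I : ClosedIdeal A) : Type u := I.toSubalgebra

instance Alg.instNormedSpace (I : ClosedIdeal A) : NormedSpace ℂ I.Alg where
  norm_smul_le c x := norm_smul_le c (x : A)

instance Alg.instCompleteSpace (I : ClosedIdeal A) [CompleteSpace A] : CompleteSpace I.Alg :=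
  haveI : IsClosed (I.toSubalgebra : Set A) := I.isClosed'
  this.completeSpace_coe

/-- The quotient algebra `A/I`, with the quotient norm. -/
def Quot (I : ClosedIdeal A) : Type u := A ⧸ I.toSubmodule

instance Quot.instNormedAddCommGroup (I : ClosedIdeal A) : NormedAddCommGroup I.Quot :=
  haveI : IsClosed (I.toSubmodule : Set A) := I.isClosed'
  inferInstanceAs (NormedAddCommGroup (A ⧸ I.toSubmodule))

instance Quot.instNormedSpace (I : ClosedIdeal A) : NormedSpace ℂ I.Quot :=
  haveI : IsClosed (I.toSubmodule : Set A) := I.isClosed'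
  inferInstanceAs (NormedSpace ℂ (A ⧸ I.toSubmodule))

/-- The quotient map `θ : A → A/I`. -/
def proj (I : ClosedIdeal A) : A →L[ℂ] I.Quot where
  toLinearMap := I.toSubmodule.mkQ
  cont := continuous_quot_mk

lemma proj_surjective (I : ClosedIdeal A) : Function.Surjective I.proj :=
  Submodule.mkQ_surjective _

lemma proj_eq_iff (I : ClosedIdeal A) {a b : A} : I.proj a = I.proj b ↔ a - b ∈ I.toSubmodule :=
  Submodule.Quotient.eq _

lemma norm_proj_le (I : ClosedIdeal A) (a : A) : ‖I.proj a‖ ≤ ‖a‖ :=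
  Submodule.Quotient.norm_mk_le I.toSubmodule a

lemma exists_proj_lt (I : ClosedIdeal A) (x : I.Quot) {ε : ℝ} (hε : 0 < ε) :
    ∃ a, I.proj a = x ∧ ‖a‖ < ‖x‖ + ε :=
  Submodule.Quotient.norm_mk_lt (S := I.toSubmodule) x hε

instance Quot.instMul (I : ClosedIdeal A) : Mul I.Quot where
  mul := Quotient.map₂ (· * ·) (by
    intro a a' h b b' h'
    replace h : a - a' ∈ I.toSubmodule := (Submodule.quotientRel_def _).1 h
    replace h' : b - b' ∈ I.toSubmodule := (Submodule.quotientRel_def _).1 h'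
    refine (Submodule.quotientRel_def _).2 ?_
    have e : a * b - a' * b' = (a - a') * b + a' * (b - b') := by
      rw [sub_mul, mul_sub]; abel
    rw [e]
    exact I.toSubmodule.add_mem (I.mul_mem_right' _ _ h) (I.mul_mem_left' _ _ h'))

lemma proj_mul (I : ClosedIdeal A) (a b : A) : I.proj (a * b) = I.proj a * I.proj b := rfl

instance Quot.instNonUnitalNormedRing (I : ClosedIdeal A) : NonUnitalNormedRing I.Quot where
  __ := Quot.instNormedAddCommGroup I
  __ := Quot.instMul I
  left_distrib x y z := by
    obtain ⟨a, rfl⟩ := I.proj_surjective x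
    obtain ⟨b, rfl⟩ := I.proj_surjective y
    obtain ⟨c, rfl⟩ := I.proj_surjective z
    rw [← map_add, ← proj_mul, ← proj_mul, ← proj_mul, mul_add, map_add]
  right_distrib x y z := by
    obtain ⟨a, rfl⟩ := I.proj_surjective x
    obtain ⟨b, rfl⟩ := I.proj_surjective y
    obtain ⟨c, rfl⟩ := I.proj_surjective z
    rw [← map_add, ← proj_mul, ← proj_mul, ← proj_mul, add_mul, map_add]
  zero_mul x := by
    obtain ⟨a, rfl⟩ := I.proj_surjective x
    rw [← map_zero I.proj, ← proj_mul, zero_mul]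
  mul_zero x := by
    obtain ⟨a, rfl⟩ := I.proj_surjective x
    rw [← map_zero I.proj, ← proj_mul, mul_zero]
  mul_assoc x y z := by
    obtain ⟨a, rfl⟩ := I.proj_surjective x
    obtain ⟨b, rfl⟩ := I.proj_surjective y
    obtain ⟨c, rfl⟩ := I.proj_surjective z
    rw [← proj_mul, ← proj_mul, ← proj_mul, ← proj_mul, mul_assoc]
  norm_mul_le x y := by
    refine le_of_forall_pos_le_add fun ε hε => ?_
    have hcont : Filter.Tendsto (fun t : ℝ => (‖x‖ + t) * (‖y‖ + t)) (𝓝[>] 0)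
        (𝓝 (‖x‖ * ‖y‖)) := by
      have : Continuous fun t : ℝ => (‖x‖ + t) * (‖y‖ + t) := by fun_prop
      simpa using (this.tendsto 0).mono_left nhdsWithin_le_nhds
    obtain ⟨t, ht, ht0⟩ := ((hcont.eventually
      (gt_mem_nhds (lt_add_of_pos_right (‖x‖ * ‖y‖) hε))).and self_mem_nhdsWithin).exists
    obtain ⟨a, rfl, ha⟩ := I.exists_proj_lt x ht0
    obtain ⟨b, rfl, hb⟩ := I.exists_proj_lt y ht0
    calc ‖I.proj a * I.proj b‖ = ‖I.proj (a * b)‖ := by rw [proj_mul]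
      _ ≤ ‖a‖ * ‖b‖ := (I.norm_proj_le _).trans (norm_mul_le a b)
      _ ≤ (‖I.proj a‖ + t) * (‖I.proj b‖ + t) := by gcongr
      _ ≤ _ := ht.le

instance Quot.instIsScalarTower (I : ClosedIdeal A) [IsScalarTower ℂ A A] :
    IsScalarTower ℂ I.Quot I.Quot where
  smul_assoc c x y := by
    obtain ⟨a, rfl⟩ := I.proj_surjective x
    obtain ⟨b, rfl⟩ := I.proj_surjective y
    simp only [smul_eq_mul, ← map_smul, ← proj_mul, smul_mul_assoc]

instance Quot.instSMulCommClass (I : ClosedIdeal A) [SMulCommClass ℂ A A] :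
    SMulCommClass ℂ I.Quot I.Quot where
  smul_comm c x y := by
    obtain ⟨a, rfl⟩ := I.proj_surjective x
    obtain ⟨b, rfl⟩ := I.proj_surjective y
    simp only [smul_eq_mul, ← map_smul, ← proj_mul, mul_smul_comm]

instance Quot.instCompleteSpace (I : ClosedIdeal A) [CompleteSpace A] : CompleteSpace I.Quot :=
  haveI : IsClosed (I.toSubmodule : Set A) := I.isClosed'
  inferInstanceAs (CompleteSpace (A ⧸ I.toSubmodule))

end ClosedIdeal

/-! ### Simplicial cohomology -/

/-- The simplicial cohomology group `Hⁿ(A, A*)`. -/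
abbrev SimplicialCohomology (A : Type u) [NonUnitalNormedRing A] [NormedSpace ℂ A]
    [IsScalarTower ℂ A A] [SMulCommClass ℂ A A] (n : ℕ) : Type u :=
  Cohomology (Bimodule.regular A).dual n

/-- The natural map `Hⁿ(A/I, (A/I)*) → Hⁿ(A, A*)`, which sends the class of `f` to the class of
`(a₁, …, aₙ) ↦ (a ↦ f (θ a₁, …, θ aₙ) (θ a))`, where `θ : A → A/I` is the quotient map. -/
def naturalMap {A : Type u} [NonUnitalNormedRing A] [NormedSpace ℂ A]
    [IsScalarTower ℂ A A] [SMulCommClass ℂ A A] (I : ClosedIdeal A) (n : ℕ) :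
    SimplicialCohomology I.Quot n →ₗ[ℂ] SimplicialCohomology A n :=
  cohomologyMap I.proj ((ContinuousLinearMap.compL ℂ A I.Quot ℂ).flip I.proj)
    (Bimodule.regular I.Quot).dual (Bimodule.regular A).dual I.proj_mul
    (fun a f => by ext x; simp [I.proj_mul]) (fun a f => by ext x; simp [I.proj_mul]) n

end BanachCohomology

end

noncomputable section

open scoped Topology

universe u v w

namespace BanachCohomology

/-! ### Reduction of dimension -/

/-! Call a cochain vanishing on `I` if it is zero as soon as one argument lies in `I`. The core is
`exists_vanishesOn_sub_coboundary`: if `N` is a dual module and `δg` vanishes on `I`, then `g` minus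
some coboundary vanishes on `I`. The proof is by reduction of dimension: currying the last variable
turns `Cⁿ⁺¹(A, Y)` into `Cⁿ(A, A →L Y)` for a twisted bimodule that is again a dual
(`HasPredual.shift`). In degree one, the restriction of `g` to `I` is a derivation, inner by
amenability. In the inductive step only the last argument remains, and `exists_vanishesOn_last`
corrects it by the cochain `lim g(·, eᵢ)`, where `(eᵢ)` is a bounded left approximate identity of
`I`; the limit is expressed by a functional on `I*`.

If `g` has positive degree, has values in `A*`, and both `g` and `δg` vanish on `I`, then evaluating
`δg` with a first argument `b ∈ I` leaves `b · g(a) = 0`. The functionals `g(a)` therefore vanish on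
`I`, and `g` comes from `A/I`. This applies to cocycles of degree at least 1 (surjectivity) and to
`g` with `δg` pulled back from `A/I` (injectivity in degree at least 2). In degree 0 the argument is
not available; there the vanishing of `δg` on `I` only says that `g` restricts to a trace on `I`,
which is where the hypothesis on the centre enters.

A bijection on cohomology is automatically a homeomorphism, by the open mapping theorem applied to
cocycles together with cochains one degree lower. -/

lemma contractNth_castSucc_snoc {α : Type*} [Mul α] {n : ℕ} (i : Fin n) (a : Fin (n + 1) → α)
    (b : α) :
    Fin.contractNth i.castSucc.castSucc (· * ·) (Fin.snoc (α := fun _ => α) a b) =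
      Fin.snoc (α := fun _ => α) (Fin.contractNth i.castSucc (· * ·) a) b := by
  funext k
  refine Fin.lastCases ?_ (fun k => ?_) k
  · rw [Fin.contractNth_apply_of_gt _ _ _ _ (by simp), Fin.snoc_last, Fin.succ_last,
      Fin.snoc_last]
  · rw [Fin.snoc_castSucc]
    simp only [Fin.contractNth, Fin.val_castSucc, Fin.succ_castSucc, Fin.snoc_castSucc]

lemma contractNth_last_snoc {α : Type*} [Mul α] {n : ℕ} (a : Fin (n + 1) → α) (b : α) :
    Fin.contractNth (Fin.last n).castSucc (· * ·) (Fin.snoc (α := fun _ => α) a b) =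
      Fin.snoc (α := fun _ => α) (Fin.init a) (a (Fin.last n) * b) := by
  funext k
  refine Fin.lastCases ?_ (fun k => ?_) k
  · rw [Fin.contractNth_apply_of_eq _ _ _ _ (by simp), Fin.snoc_last, Fin.succ_last,
      Fin.snoc_last, Fin.snoc_castSucc]
  · rw [Fin.contractNth_apply_of_lt _ _ _ _ (by simp), Fin.snoc_castSucc, Fin.snoc_castSucc]
    rfl

lemma tail_snoc {α : Type*} {n : ℕ} (a : Fin (n + 1) → α) (b : α) :
    Fin.tail (Fin.snoc (α := fun _ => α) a b) = Fin.snoc (α := fun _ => α) (Fin.tail a) b := by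
  funext k
  refine Fin.lastCases ?_ (fun k => ?_) k
  · simp [Fin.tail, -Fin.succ_last, Fin.succ_last n]
  · simp [Fin.tail, Fin.succ_castSucc, -Fin.castSucc_succ]

section Shift

variable {A : Type u} [NonUnitalNormedRing A] [NormedSpace ℂ A]
  {Y : Type v} [NormedAddCommGroup Y] [NormedSpace ℂ Y]

/-- Currying of the last variable, `Cⁿ⁺¹(A, Y) → Cⁿ(A, A →L Y)`. -/
def curryLast {n : ℕ} (f : Cochain A Y (n + 1)) : Cochain A (A →L[ℂ] Y) n :=
  ContinuousMultilinearMap.curryRight f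

@[simp] lemma curryLast_apply {n : ℕ} (f : Cochain A Y (n + 1)) (a : Fin n → A) (b : A) :
    curryLast f a b = f (Fin.snoc (α := fun _ => A) a b) := rfl

/-- Uncurrying of the last variable, `Cⁿ(A, A →L Y) → Cⁿ⁺¹(A, Y)`. -/
def uncurryLast {n : ℕ} (f : Cochain A (A →L[ℂ] Y) n) : Cochain A Y (n + 1) :=
  ContinuousMultilinearMap.uncurryRight (Ei := fun _ : Fin (n + 1) => A) f

@[simp] lemma curryLast_uncurryLast {n : ℕ} (f : Cochain A (A →L[ℂ] Y) n) :
    curryLast (uncurryLast f) = f :=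
  ContinuousMultilinearMap.curry_uncurryRight (Ei := fun _ : Fin (n + 1) => A) f

variable [IsScalarTower ℂ A A] [SMulCommClass ℂ A A]

/-- The bimodule structure `(a · T)(b) = a · T b` and `(T · a)(b) = T (a b) - T a · b` on the space
of bounded operators `A → Y`, for which `Cⁿ⁺¹(A, Y)` is `Cⁿ(A, A →L Y)` as a complex. -/
def Bimodule.shift (N : Bimodule A Y) : Bimodule A (A →L[ℂ] Y) where
  left := (ContinuousLinearMap.compL ℂ A Y Y).comp N.left
  right := (ContinuousLinearMap.compL ℂ A A Y).flip.comp (ContinuousLinearMap.mul ℂ A)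
    - (ContinuousLinearMap.compL ℂ (A →L[ℂ] Y) Y (A →L[ℂ] Y) N.right.flip).comp
        (ContinuousLinearMap.apply ℂ Y)
  left_mul a b T := by ext x; simp [N.left_mul]
  right_mul a b T := by ext x; simp [N.right_mul, mul_assoc]
  left_right a b T := by ext x; simp [N.left_right]

@[simp] lemma Bimodule.shift_left_apply (N : Bimodule A Y) (a : A) (T : A →L[ℂ] Y) (b : A) :
    N.shift.left a T b = N.left a (T b) := rfl

@[simp] lemma Bimodule.shift_right_apply (N : Bimodule A Y) (a : A) (T : A →L[ℂ] Y) (b : A) :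
    N.shift.right a T b = T (a * b) - N.right b (T a) := rfl

lemma curryLast_coboundary (N : Bimodule A Y) (n : ℕ) (f : Cochain A Y (n + 1)) :
    curryLast (coboundary N (n + 1) f) = coboundary N.shift n (curryLast f) := by
  ext a b
  have h0 : (Fin.snoc (α := fun _ => A) a b : Fin (n + 1 + 1) → A) 0 = a 0 := by
    rw [← Fin.castSucc_zero, Fin.snoc_castSucc]
  rw [curryLast_apply, coboundary_apply, coboundary_apply, Fin.sum_univ_castSucc]
  simp only [contractNth_castSucc_snoc, contractNth_last_snoc, tail_snoc, h0, Fin.snoc_last,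
    Fin.init_snoc, add_apply, sum_apply,
    smul_apply, Bimodule.shift_left_apply, Bimodule.shift_right_apply,
    curryLast_apply, Fin.snoc_init_self, Fin.val_castSucc, Fin.val_last, smul_sub]
  rw [pow_succ (-1 : ℂ) (n + 1)]
  simp only [mul_neg, mul_one, neg_smul]
  abel

lemma coboundary_snoc (N : Bimodule A Y) (n : ℕ) (f : Cochain A Y (n + 1)) (a : Fin (n + 1) → A)
    (b : A) : coboundary N (n + 1) f (Fin.snoc (α := fun _ => A) a b) =
      coboundary N.shift n (curryLast f) a b := by
  rw [← curryLast_coboundary]; rfl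

/-- Currying the last variable reduces the identity to degree 0. The coefficients share the universe
of `A` so that `A →L[ℂ] Y` stays within the scope of the induction. -/
lemma coboundary_coboundary {Y : Type u} [NormedAddCommGroup Y] [NormedSpace ℂ Y]
    (N : Bimodule A Y) (n : ℕ) (f : Cochain A Y n) :
    coboundary N (n + 1) (coboundary N n f) = 0 := by
  induction n generalizing Y with
  | zero =>
    ext a
    have h : ∀ m : Fin 0 → A, f m = f 0 := fun m => congrArg f (Subsingleton.elim _ _)
    have e1 : Fin.contractNth 0 (· * ·) a 0 = a 0 * a 1 := rfl
    have e2 : Fin.init a 0 = a 0 := rfl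
    have e3 : Fin.tail a 0 = a 1 := rfl
    simp [coboundary_apply, h, e1, e2, e3, N.left_mul, N.right_mul, N.left_right]
    abel
  | succ n ih =>
    ext a
    rw [← Fin.snoc_init_self a, coboundary_snoc, curryLast_coboundary, ih]
    rfl

end Shift

/-! ### Bimodules with a predual -/

section Predual

variable {A : Type u} [NonUnitalNormedRing A] [NormedSpace ℂ A]

/-- The restriction of the actions to an invariant subspace. -/
def Bimodule.restrict {X : Type v} [NormedAddCommGroup X] [NormedSpace ℂ X] (M : Bimodule A X)
    (W : Submodule ℂ X) (hl : ∀ a, ∀ x ∈ W, M.left a x ∈ W) (hr : ∀ a, ∀ x ∈ W, M.right a x ∈ W) :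
    Bimodule A W where
  left := LinearMap.mkContinuous₂
    (LinearMap.mk₂ ℂ (fun a (x : W) => (⟨M.left a x, hl a x x.2⟩ : W))
      (fun a b x => by ext; simp) (fun c a x => by ext; simp) (fun a x y => by ext; simp)
      (fun c a x => by ext; simp))
    ‖M.left‖ (fun a x => M.left.le_opNorm₂ a x)
  right := LinearMap.mkContinuous₂
    (LinearMap.mk₂ ℂ (fun a (x : W) => (⟨M.right a x, hr a x x.2⟩ : W))
      (fun a b x => by ext; simp) (fun c a x => by ext; simp) (fun a x y => by ext; simp)
      (fun c a x => by ext; simp))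
    ‖M.right‖ (fun a x => M.right.le_opNorm₂ a x)
  left_mul a b x := Subtype.ext (M.left_mul a b x)
  right_mul a b x := Subtype.ext (M.right_mul a b x)
  left_right a b x := Subtype.ext (M.left_right a b x)

/-- An isomorphism of the bimodule `Y` with the dual of a Banach bimodule. -/
structure Predual {Y : Type u} [NormedAddCommGroup Y] [NormedSpace ℂ Y] (N : Bimodule A Y)
    (Q : Type u) [NormedAddCommGroup Q] [NormedSpace ℂ Q] where
  bimodule : Bimodule A Q
  equiv : Y ≃L[ℂ] StrongDual ℂ Q
  equiv_left : ∀ a y q, equiv (N.left a y) q = equiv y (bimodule.right a q)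
  equiv_right : ∀ a y q, equiv (N.right a y) q = equiv y (bimodule.left a q)

/-- `N` is isomorphic to the dual of a Banach bimodule. -/
def HasPredual {Y : Type u} [NormedAddCommGroup Y] [NormedSpace ℂ Y] (N : Bimodule A Y) : Prop :=
  ∃ (Q : Type u) (_ : NormedAddCommGroup Q) (_ : NormedSpace ℂ Q) (_ : CompleteSpace Q),
    Nonempty (Predual N Q)

lemma hasPredual_dual {X : Type u} [NormedAddCommGroup X] [NormedSpace ℂ X] [CompleteSpace X]
    (M : Bimodule A X) : HasPredual M.dual :=
  ⟨X, inferInstance, inferInstance, inferInstance,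
    ⟨⟨M, ContinuousLinearEquiv.refl ℂ _, fun _ _ _ => rfl, fun _ _ _ => rfl⟩⟩⟩

section ClosedSpan

variable {Q : Type v} [NormedAddCommGroup Q] [NormedSpace ℂ Q]
  {D : Type w} [NormedAddCommGroup D] [NormedSpace ℂ D]

/-- The closed linear span of the range of a bounded bilinear map. -/
def closedSpan (v : A →L[ℂ] Q →L[ℂ] D) : Submodule ℂ D :=
  (Submodule.span ℂ {w | ∃ a q, w = v a q}).topologicalClosure

variable (v : A →L[ℂ] Q →L[ℂ] D)

lemma mem_closedSpan (a : A) (q : Q) : v a q ∈ closedSpan v :=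
  Submodule.le_topologicalClosure _ (Submodule.subset_span ⟨a, q, rfl⟩)

lemma map_mem_closedSpan (S : D →L[ℂ] D) (hS : ∀ a q, S (v a q) ∈ closedSpan v) :
    ∀ w ∈ closedSpan v, S w ∈ closedSpan v := by
  have h : closedSpan v ≤ (closedSpan v).comap (S : D →ₗ[ℂ] D) := by
    refine Submodule.topologicalClosure_minimal _ (Submodule.span_le.2 ?_) ?_
    · rintro _ ⟨a, q, rfl⟩
      exact hS a q
    · exact (Submodule.isClosed_topologicalClosure _).preimage S.continuous
  exact h

lemma closedSpan_ext {F G : StrongDual ℂ (closedSpan v)}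
    (h : ∀ a q, F ⟨v a q, mem_closedSpan v a q⟩ = G ⟨v a q, mem_closedSpan v a q⟩) : F = G := by
  have hd : Dense (Submodule.span ℂ {w : closedSpan v | ∃ a q, (w : D) = v a q} :
      Set (closedSpan v)) := by
    intro w
    rw [closure_subtype]
    refine closure_mono ?_ w.2
    intro x hx
    have hx' : x ∈ (Submodule.span ℂ {w : closedSpan v | ∃ a q, (w : D) = v a q}).map
        (closedSpan v).subtype := by
      refine Submodule.span_le.2 ?_ hx
      rintro _ ⟨a, q, rfl⟩
      exact ⟨⟨_, mem_closedSpan v a q⟩, Submodule.subset_span ⟨a, q, rfl⟩, rfl⟩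
    exact hx'
  refine ContinuousLinearMap.ext_on hd ?_
  rintro ⟨_, _⟩ ⟨a, q, rfl⟩
  exact h a q

/-- A bounded bilinear map as a map into the closed linear span of its range. -/
def toClosedSpan : A →L[ℂ] Q →L[ℂ] closedSpan v :=
  LinearMap.mkContinuous₂
    (LinearMap.mk₂ ℂ (fun a q => ⟨_, mem_closedSpan v a q⟩)
      (fun a b q => by ext; simp) (fun c a q => by ext; simp) (fun a q r => by ext; simp)
      (fun c a q => by ext; simp))
    ‖v‖ (fun a q => v.le_opNorm₂ a q)

end ClosedSpan

/-- Restricting functionals to the closed span `W` of the vectors `v a q` maps `E` to `W*`. A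
functional on `W` is determined by the bilinear form it induces on `A × Q`, so `hinj` and `hsurj`
give bijectivity. The inverse is bounded by the open mapping theorem; no norm is computed. -/
lemma hasPredual_of_pairing {E D : Type u} [NormedAddCommGroup E] [NormedSpace ℂ E]
    [CompleteSpace E] [NormedAddCommGroup D] [NormedSpace ℂ D] [CompleteSpace D]
    {Q : Type v} [NormedAddCommGroup Q] [NormedSpace ℂ Q]
    (M : Bimodule A E) (P : Bimodule A D) (p : E →L[ℂ] StrongDual ℂ D)
    (hl : ∀ a y d, p (M.left a y) d = p y (P.right a d))
    (hr : ∀ a y d, p (M.right a y) d = p y (P.left a d))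
    (v : A →L[ℂ] Q →L[ℂ] D)
    (hvl : ∀ a b q, P.left a (v b q) ∈ closedSpan v)
    (hvr : ∀ a b q, P.right a (v b q) ∈ closedSpan v)
    (hinj : ∀ y, (∀ a q, p y (v a q) = 0) → y = 0)
    (hsurj : ∀ F : A →L[ℂ] StrongDual ℂ Q, ∃ y, ∀ a q, p y (v a q) = F a q) :
    HasPredual M := by
  let r : E →L[ℂ] StrongDual ℂ (closedSpan v) :=
    ((ContinuousLinearMap.compL ℂ (closedSpan v) D ℂ).flip (closedSpan v).subtypeL).comp p
  have hker : r.ker = ⊥ := LinearMap.ker_eq_bot'.2 fun y hy =>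
    hinj y fun a q => DFunLike.congr_fun hy (toClosedSpan v a q)
  have hrange : r.range = ⊤ := LinearMap.range_eq_top.2 fun F => by
    obtain ⟨y, hy⟩ := hsurj ((ContinuousLinearMap.compL ℂ Q _ ℂ F).comp (toClosedSpan v))
    exact ⟨y, closedSpan_ext v hy⟩
  exact ⟨closedSpan v, inferInstance, inferInstance,
    (Submodule.isClosed_topologicalClosure _).completeSpace_coe,
    ⟨⟨P.restrict _ (fun a => map_mem_closedSpan v _ (hvl a))
      (fun a => map_mem_closedSpan v _ (hvr a)),
      ContinuousLinearEquiv.ofBijective r hker hrange,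
      fun a y q => hl a y q, fun a y q => hr a y q⟩⟩⟩

section Evaluations

variable {Y : Type u} [NormedAddCommGroup Y] [NormedSpace ℂ Y]
  {Q : Type u} [NormedAddCommGroup Q] [NormedSpace ℂ Q]

/-- The functional `T ↦ e (T a) q` on the space of operators `A → Y`. -/
def evalFunctional (e : Y →L[ℂ] StrongDual ℂ Q) : A →L[ℂ] Q →L[ℂ] StrongDual ℂ (A →L[ℂ] Y) :=
  LinearMap.mkContinuous₂
    (LinearMap.mk₂ ℂ (fun a q => ((ContinuousLinearMap.apply ℂ ℂ q).comp e).comp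
        (ContinuousLinearMap.apply ℂ Y a))
      (fun a b q => by ext; simp) (fun c a q => by ext; simp) (fun a q r => by ext; simp)
      (fun c a q => by ext; simp))
    ‖e‖ (fun a q => ContinuousLinearMap.opNorm_le_bound _ (by positivity) fun T => by
      change ‖e (T a) q‖ ≤ _
      calc ‖e (T a) q‖ ≤ ‖e‖ * ‖T a‖ * ‖q‖ := e.le_opNorm₂ _ _
        _ ≤ ‖e‖ * (‖T‖ * ‖a‖) * ‖q‖ := by gcongr; exact T.le_opNorm a
        _ = ‖e‖ * ‖a‖ * ‖q‖ * ‖T‖ := by ring)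

@[simp] lemma evalFunctional_apply (e : Y →L[ℂ] StrongDual ℂ Q) (a : A) (q : Q) (T : A →L[ℂ] Y) :
    evalFunctional e a q T = e (T a) q := rfl

end Evaluations

variable [IsScalarTower ℂ A A] [SMulCommClass ℂ A A]

/-- If `Y ≅ Q*`, then `A →L Y` is the dual of the projective tensor product of `A` and `Q`. Here the
closed span of the functionals `T ↦ e (T a) q` plays the part of that tensor product; what needs
checking is its invariance under the twisted actions. -/
lemma HasPredual.shift {Y : Type u} [NormedAddCommGroup Y] [NormedSpace ℂ Y] [CompleteSpace Y]
    {N : Bimodule A Y} (hN : HasPredual N) : HasPredual N.shift := by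
  obtain ⟨Q, _, _, _, ⟨P, e, hl, hr⟩⟩ := hN
  refine hasPredual_of_pairing N.shift N.shift.dual
    (NormedSpace.inclusionInDoubleDual ℂ (A →L[ℂ] Y)) (fun _ _ _ => rfl) (fun _ _ _ => rfl)
    (evalFunctional (e : Y →L[ℂ] StrongDual ℂ Q)) (fun a b q => ?_) (fun a b q => ?_)
    (fun T hT => ?_) (fun F => ?_)
  · have : N.shift.dual.left a (evalFunctional (e : Y →L[ℂ] StrongDual ℂ Q) b q) =
        evalFunctional (e : Y →L[ℂ] StrongDual ℂ Q) (a * b) q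
          - evalFunctional (e : Y →L[ℂ] StrongDual ℂ Q) a (P.left b q) := by
      ext T; simp [hr]
    rw [this]
    exact sub_mem (mem_closedSpan _ _ _) (mem_closedSpan _ _ _)
  · have : N.shift.dual.right a (evalFunctional (e : Y →L[ℂ] StrongDual ℂ Q) b q) =
        evalFunctional (e : Y →L[ℂ] StrongDual ℂ Q) b (P.right a q) := by
      ext T; simp [hl]
    rw [this]
    exact mem_closedSpan _ _ _
  · ext a
    exact e.injective (ContinuousLinearMap.ext fun q => by simpa using hT a q)
  · exact ⟨(e.symm : StrongDual ℂ Q →L[ℂ] Y).comp F, fun a q => by simp⟩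

end Predual

/-! ### Consequences of amenability -/

section Amenable

lemma IsAmenable.exists_inner {B : Type u} [NonUnitalNormedRing B] [NormedSpace ℂ B]
    [IsScalarTower ℂ B B] [SMulCommClass ℂ B B] (hB : IsAmenable B)
    {X : Type u} [NormedAddCommGroup X] [NormedSpace ℂ X] [CompleteSpace X] (M : Bimodule B X)
    (D : B →L[ℂ] StrongDual ℂ X)
    (hD : ∀ a b, D (a * b) = M.dual.left a (D b) + M.dual.right b (D a)) :
    ∃ y, ∀ a, D a = M.dual.left a y - M.dual.right a y := by
  let f : Cochain B (StrongDual ℂ X) 1 := ContinuousMultilinearMap.ofSubsingleton ℂ B _ 0 D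
  have hf : f ∈ cocycles M.dual 1 := by
    change coboundary M.dual 1 f = 0
    ext1 a
    have e1 : Fin.contractNth 0 (· * ·) a 0 = a 0 * a 1 := rfl
    have e2 : Fin.init a 0 = a 0 := rfl
    have e3 : Fin.tail a 0 = a 1 := rfl
    simp [coboundary_apply, f, e1, e2, e3, hD]
  have h := hB X M
  obtain ⟨y, hy⟩ : f ∈ LinearMap.range (coboundary M.dual 0) :=
    (Submodule.Quotient.mk_eq_zero _ (x := (⟨f, hf⟩ : cocycles M.dual 1))).1 (h.elim _ _)
  refine ⟨y 0, fun a => ?_⟩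
  have := DFunLike.congr_fun hy (fun _ => a)
  rw [coboundary_apply, Subsingleton.elim (Fin.tail _) 0, Subsingleton.elim (Fin.init _) 0] at this
  simpa [f, sub_eq_add_neg] using this.symm

/-- The bimodule with the same left action and zero right action. -/
def Bimodule.dropRight {A : Type u} [NonUnitalNormedRing A] [NormedSpace ℂ A]
    {X : Type v} [NormedAddCommGroup X] [NormedSpace ℂ X] (M : Bimodule A X) : Bimodule A X where
  left := M.left
  right := 0
  left_mul := M.left_mul
  right_mul a b x := by simp
  left_right a b x := by simp

/-- The restriction of the actions along a homomorphism. -/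
def Bimodule.comp {A : Type u} [NonUnitalNormedRing A] [NormedSpace ℂ A]
    {B : Type w} [NonUnitalNormedRing B] [NormedSpace ℂ B]
    {X : Type v} [NormedAddCommGroup X] [NormedSpace ℂ X] (M : Bimodule A X) (θ : B →L[ℂ] A)
    (hθ : ∀ a b, θ (a * b) = θ a * θ b) : Bimodule B X where
  left := M.left.comp θ
  right := M.right.comp θ
  left_mul a b x := by simp [hθ, M.left_mul]
  right_mul a b x := by simp [hθ, M.right_mul]
  left_right a b x := by simp [M.left_right]

/-- A left identity of the second dual, as a module over the algebra. -/
lemma IsAmenable.exists_mean {B : Type u} [NonUnitalNormedRing B] [NormedSpace ℂ B]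
    [IsScalarTower ℂ B B] [SMulCommClass ℂ B B] (hB : IsAmenable B) :
    ∃ E : StrongDual ℂ (StrongDual ℂ B), ∀ (φ : StrongDual ℂ B) (b : B),
      E ((Bimodule.regular B).dual.left b φ) = φ b := by
  -- When `B*` carries the zero right action, its dual has zero left action, and a derivation is an
  -- operator with `D (a * b) = D a · b`. The embedding `B → B**` is one; being inner means `D b =
  -- -(y · b)`, hence the witness `-y`.
  obtain ⟨y, hy⟩ := hB.exists_inner (Bimodule.regular B).dual.dropRight
    (NormedSpace.inclusionInDoubleDual ℂ B) (fun a b => by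
      ext φ
      simp [Bimodule.dropRight])
  refine ⟨-y, fun φ b => ?_⟩
  have := DFunLike.congr_fun (hy b) φ
  simpa [Bimodule.dropRight] using this.symm

end Amenable

/-! ### Amenable ideals: inner derivations and averaging -/

namespace ClosedIdeal

variable {A : Type u} [NonUnitalNormedRing A] [NormedSpace ℂ A]

/-- The inclusion `I → A`. -/
def incl (I : ClosedIdeal A) : I.Alg →L[ℂ] A where
  toFun := Subtype.val
  map_add' _ _ := rfl
  map_smul' _ _ := rfl
  cont := continuous_subtype_val

@[simp] lemma incl_apply (I : ClosedIdeal A) (b : I.Alg) : I.incl b = b := rfl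

lemma coe_mem (I : ClosedIdeal A) (b : I.Alg) : (b : A) ∈ I.toSubmodule := b.2

variable [IsScalarTower ℂ A A] [SMulCommClass ℂ A A]
  {Y : Type u} [NormedAddCommGroup Y] [NormedSpace ℂ Y]

lemma exists_inner (I : ClosedIdeal A) (hI : IsAmenable I.Alg) {N : Bimodule A Y}
    (hN : HasPredual N) (D : A →L[ℂ] Y)
    (hD : ∀ a ∈ I.toSubmodule, ∀ b ∈ I.toSubmodule,
      D (a * b) = N.left a (D b) + N.right b (D a)) :
    ∃ y, ∀ a ∈ I.toSubmodule, D a = N.left a y - N.right a y := by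
  obtain ⟨Q, _, _, _, ⟨P, e, hl, hr⟩⟩ := hN
  obtain ⟨y, hy⟩ := hI.exists_inner (P.comp I.incl fun _ _ => rfl)
    ((e : Y →L[ℂ] StrongDual ℂ Q).comp (D.comp I.incl)) (fun a b => by
      ext q
      have := hD a (I.coe_mem a) b (I.coe_mem b)
      simp [Bimodule.comp, this, hl, hr])
  refine ⟨e.symm y, fun a ha => e.injective ?_⟩
  ext q
  have := DFunLike.congr_fun (hy ⟨a, ha⟩) q
  simpa [Bimodule.comp, hl, hr] using this

/-- An averaging operator, which replaces the limit of `S (e_i)` along a bounded left approximate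
identity `(e_i)` of `I`. -/
lemma exists_average (I : ClosedIdeal A) (hI : IsAmenable I.Alg) {N : Bimodule A Y}
    (hN : HasPredual N) :
    ∃ τ : (A →L[ℂ] Y) →L[ℂ] Y,
      (∀ S S' : A →L[ℂ] Y, (∀ x ∈ I.toSubmodule, S x = S' x) → τ S = τ S') ∧
      (∀ a S, N.left a (τ S) = τ ((N.left a).comp S)) ∧
      (∀ a S, N.right a (τ S) = τ ((N.right a).comp S)) ∧
      ∀ b ∈ I.toSubmodule, ∀ S : A →L[ℂ] Y, τ (S.comp ((Bimodule.regular A).right b)) = S b := by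
  obtain ⟨Q, _, _, _, ⟨P, e, hl, hr⟩⟩ := hN
  obtain ⟨E, hE⟩ := hI.exists_mean
  let e' : Y →L[ℂ] StrongDual ℂ Q := e
  -- `σ S` is the functional `q ↦ E (x ↦ e (S x) q)`, a weak-* limit of `S (eᵢ)`.
  let σ : (A →L[ℂ] Y) →L[ℂ] StrongDual ℂ Q :=
    (ContinuousLinearMap.compL ℂ Q (StrongDual ℂ I.Alg) ℂ E).comp
      (((ContinuousLinearMap.flipₗᵢ ℂ I.Alg Q ℂ).toContinuousLinearEquiv :
        (I.Alg →L[ℂ] Q →L[ℂ] ℂ) →L[ℂ] Q →L[ℂ] I.Alg →L[ℂ] ℂ).comp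
        ((ContinuousLinearMap.compL ℂ I.Alg Y (StrongDual ℂ Q) e').comp
          ((ContinuousLinearMap.compL ℂ I.Alg A Y).flip I.incl)))
  have hσ : ∀ S q (φ : StrongDual ℂ I.Alg), (∀ b : I.Alg, φ b = e (S b) q) → σ S q = E φ := by
    intro S q φ h
    change E _ = E φ
    congr 1
    ext b
    exact (h b).symm
  -- Allowing two vectors `q`, `r` lets the module actions be moved to the predual, so that they
  -- commute with the weak-* limit.
  have hτ : ∀ S T : A →L[ℂ] Y, ∀ q r : Q,
      (∀ x ∈ I.toSubmodule, e (S x) q = e (T x) r) → σ S q = σ T r := by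
    intro S T q r h
    rw [hσ S q (((ContinuousLinearMap.apply ℂ ℂ r).comp e').comp (T.comp I.incl)),
      hσ T r (((ContinuousLinearMap.apply ℂ ℂ r).comp e').comp (T.comp I.incl))]
    · exact fun b => rfl
    · exact fun b => (h b (I.coe_mem b)).symm
  refine ⟨(e.symm : StrongDual ℂ Q →L[ℂ] Y).comp σ, fun S S' h => ?_, fun a S => ?_, fun a S => ?_,
    fun b hb S => ?_⟩ <;> refine e.injective (ContinuousLinearMap.ext fun q => ?_)
  · simpa using hτ S S' q q fun x hx => by rw [h x hx]
  · simpa [hl] using hτ S _ _ q fun x hx => by simp [hl]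
  · simpa [hr] using hτ S _ _ q fun x hx => by simp [hr]
  · let φ : StrongDual ℂ I.Alg := ((ContinuousLinearMap.apply ℂ ℂ q).comp e').comp (S.comp I.incl)
    have := hσ (S.comp ((Bimodule.regular A).right b)) q
      ((Bimodule.regular I.Alg).dual.left ⟨b, hb⟩ φ) (fun x => rfl)
    rw [hE] at this
    change e (e.symm (σ _)) q = _
    rw [e.apply_symm_apply]
    exact this

/-- `b · φ = 0` says `φ (x * b) = 0` for all `x`, and `φ b` is the mean of `x ↦ φ (x * b)` over `I`.
-/
lemma eq_zero_of_left (I : ClosedIdeal A) (hI : IsAmenable I.Alg) (φ : StrongDual ℂ A)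
    (h : ∀ b ∈ I.toSubmodule, (Bimodule.regular A).dual.left b φ = 0) :
    ∀ b ∈ I.toSubmodule, φ b = 0 := by
  intro b hb
  obtain ⟨E, hE⟩ := hI.exists_mean
  have h0 : (Bimodule.regular I.Alg).dual.left ⟨b, hb⟩ (φ.comp I.incl) = 0 := by
    ext x
    exact DFunLike.congr_fun (h b hb) (x : A)
  have := hE (φ.comp I.incl) ⟨b, hb⟩
  rw [h0, map_zero] at this
  exact this.symm

end ClosedIdeal

/-! ### Cochains vanishing on an ideal -/

section Vanishing

variable {A : Type u} [NonUnitalNormedRing A] [NormedSpace ℂ A]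

/-- The cochain `f` vanishes as soon as one of its arguments lies in `I`. -/
def VanishesOn {Y : Type v} [NormedAddCommGroup Y] [NormedSpace ℂ Y] (I : ClosedIdeal A) {n : ℕ}
    (f : Cochain A Y n) : Prop :=
  ∀ a : Fin n → A, (∃ i, a i ∈ I.toSubmodule) → f a = 0

lemma exists_contractNth_mem (I : ClosedIdeal A) {n : ℕ} (j : Fin n) {a : Fin (n + 1) → A}
    (h : ∃ i, a i ∈ I.toSubmodule) :
    ∃ k, Fin.contractNth j.castSucc (· * ·) a k ∈ I.toSubmodule := by
  obtain ⟨i, hi⟩ := h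
  rcases lt_trichotomy (i : ℕ) j with hij | hij | hij
  · refine ⟨⟨i, by omega⟩, ?_⟩
    rw [Fin.contractNth_apply_of_lt _ _ _ _ (by simpa using hij)]
    exact hi
  · refine ⟨j, ?_⟩
    have : j.castSucc = i := by ext; simp [hij]
    rw [Fin.contractNth_apply_of_eq _ _ _ _ (by simp), this]
    exact I.mul_mem_right' _ _ hi
  · by_cases hj : (i : ℕ) = j + 1
    · refine ⟨j, ?_⟩
      have : j.succ = i := by ext; simp [hj]
      rw [Fin.contractNth_apply_of_eq _ _ _ _ (by simp), this]
      exact I.mul_mem_left' _ _ hi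
    · refine ⟨⟨i - 1, by omega⟩, ?_⟩
      rw [Fin.contractNth_apply_of_gt _ _ _ _ (by simp; omega)]
      have : Fin.succ (⟨i - 1, by omega⟩ : Fin n) = i := by ext; simp; omega
      rw [this]
      exact hi

variable [IsScalarTower ℂ A A] [SMulCommClass ℂ A A]

namespace VanishesOn

variable {I : ClosedIdeal A} {Y : Type v} [NormedAddCommGroup Y] [NormedSpace ℂ Y]
  {N : Bimodule A Y} {n : ℕ}

/-- Since `I` is two-sided, multiplying adjacent entries keeps some entry in `I`, so only the two
outer terms survive. -/
lemma coboundary_apply {f : Cochain A Y n} (hf : VanishesOn I f) {a : Fin (n + 1) → A}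
    (h : ∃ i, a i ∈ I.toSubmodule) :
    coboundary N n f a = N.left (a 0) (f (Fin.tail a))
      + (-1 : ℂ) ^ (n + 1) • N.right (a (Fin.last n)) (f (Fin.init a)) := by
  rw [BanachCohomology.coboundary_apply, Finset.sum_eq_zero, add_zero]
  intro j _
  rw [hf _ (exists_contractNth_mem I j h), smul_zero]

/-- In `δf(b, a)` the last term contains `f(b, …)`, which vanishes because the degree of `f` is
positive; only `b · f(a)` is left. -/
lemma left_apply_eq_zero {f : Cochain A Y (n + 1)} (hf : VanishesOn I f)
    (hδ : VanishesOn I (coboundary N (n + 1) f)) {b : A} (hb : b ∈ I.toSubmodule)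
    (a : Fin (n + 1) → A) : N.left b (f a) = 0 := by
  have h0 : ∃ i, (Fin.cons b a : Fin (n + 2) → A) i ∈ I.toSubmodule := ⟨0, by simpa using hb⟩
  have h := hδ (Fin.cons b a) h0
  have hi : f (Fin.init (Fin.cons b a : Fin (n + 2) → A)) = 0 :=
    hf _ ⟨0, by simpa [Fin.init] using hb⟩
  rw [hf.coboundary_apply h0, hi] at h
  simpa using h

end VanishesOn

variable {I : ClosedIdeal A} {Y : Type u} [NormedAddCommGroup Y] [NormedSpace ℂ Y]

/-- The correction is `T(c) = τ(g(c, ·))`, that is `lim g(c, eᵢ)`. On tuples with an entry in `I`,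
`δT` reduces to its outer terms, and these give `g` up to sign. -/
lemma exists_vanishesOn_last (hI : IsAmenable I.Alg) {N : Bimodule A Y}
    (hN : HasPredual N) {n : ℕ} {g : Cochain A Y (n + 2)} (hg : VanishesOn I (curryLast g))
    (hδ : VanishesOn I (coboundary N (n + 2) g)) :
    ∃ T : Cochain A Y (n + 1), VanishesOn I (g - coboundary N (n + 1) T) := by
  obtain ⟨τ, hτ, hl, hr, hb⟩ := I.exists_average hI hN
  let T : Cochain A Y (n + 1) := τ.compContinuousMultilinearMap (curryLast g)
  have hTa : ∀ c, T c = τ (curryLast g c) := fun _ => rfl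
  have hδ' : VanishesOn I (coboundary N.shift (n + 1) (curryLast g)) := by
    intro c hc
    obtain ⟨i, hi⟩ := hc
    ext b
    rw [← coboundary_snoc]
    exact hδ _ ⟨i.castSucc, by rwa [Fin.snoc_castSucc]⟩
  have hT : VanishesOn I T := fun c hc => by rw [hTa, hg c hc, map_zero]
  have hTl : ∀ b ∈ I.toSubmodule, ∀ c, N.left b (T c) = 0 := fun b hb c => by
    rw [hTa, hl]
    change τ (N.shift.left b (curryLast g c)) = 0
    rw [hg.left_apply_eq_zero hδ' hb, map_zero]
  -- For `x ∈ I`, evaluating the twisted coboundary at `(c, x)` leaves `g(c, x * b) = g(c, x) · b`.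
  -- Averaging over `x` gives `g(c, b)` on the left and `T(c) · b` on the right.
  have hTr : ∀ b ∈ I.toSubmodule, ∀ c, N.right b (T c) = curryLast g c b := fun b hb' c => by
    rw [hTa, hr, ← hb b hb']
    refine hτ _ _ fun x hx => ?_
    have hx' : ∃ i, (Fin.snoc (α := fun _ => A) c x : Fin (n + 2) → A) i ∈ I.toSubmodule :=
      ⟨Fin.last _, by rwa [Fin.snoc_last]⟩
    have h := DFunLike.congr_fun (hδ' _ hx') b
    rw [hg.coboundary_apply hx', tail_snoc,
      hg (Fin.snoc _ _) ⟨Fin.last _, by rwa [Fin.snoc_last]⟩, map_zero, zero_add,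
      Fin.snoc_last, Fin.init_snoc] at h
    have h' := (smul_eq_zero.1 h).resolve_left (pow_ne_zero _ (by norm_num))
    exact (sub_eq_zero.1 h').symm
  refine ⟨(-1 : ℂ) ^ n • T, fun a ha => ?_⟩
  have hgoal : coboundary N (n + 1) T a = (-1 : ℂ) ^ n • g a := by
    rw [hT.coboundary_apply ha]
    rw [← Fin.snoc_init_self a] at ha ⊢
    generalize Fin.init a = c at ha ⊢
    generalize a (Fin.last (n + 1)) = b at ha ⊢
    rw [Fin.init_snoc, Fin.snoc_last, tail_snoc, ← curryLast_apply g]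
    obtain ⟨i, hi⟩ := ha
    revert hi
    -- If the last entry is in `I`, `hTr` gives `g`; if the first is, `hTl` kills the left term; if
    -- only a middle one is known to be, every term vanishes.
    refine Fin.lastCases (fun hi => ?_) (fun i hi => ?_) i
    · rw [Fin.snoc_last] at hi
      rw [hT (Fin.snoc _ _) ⟨Fin.last _, by rwa [Fin.snoc_last]⟩, map_zero, zero_add, hTr b hi]
      ring_nf
    · rw [Fin.snoc_castSucc] at hi
      rw [hT c ⟨i, hi⟩, hg c ⟨i, hi⟩, map_zero, smul_zero, add_zero, zero_apply, smul_zero]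
      revert hi
      refine Fin.cases (fun hi => ?_) (fun i hi => ?_) i
      · rw [← Fin.castSucc_zero, Fin.snoc_castSucc]
        exact hTl _ hi _
      · rw [hT (Fin.snoc _ _) ⟨i.castSucc, by rwa [Fin.snoc_castSucc]⟩, map_zero]
  rw [map_smul, sub_apply, smul_apply, hgoal, smul_smul, ← mul_pow]
  simp

/-- If `δ g` vanishes as soon as one of its arguments lies in the amenable ideal `I`, then `g` has
the same property up to a coboundary. -/
theorem exists_vanishesOn_sub_coboundary [CompleteSpace Y] (hI : IsAmenable I.Alg)
    {N : Bimodule A Y} (hN : HasPredual N) {n : ℕ} (g : Cochain A Y (n + 1))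
    (hδ : VanishesOn I (coboundary N (n + 1) g)) :
    ∃ h : Cochain A Y n, VanishesOn I (g - coboundary N n h) := by
  induction n generalizing Y with
  | zero =>
    let D : A →L[ℂ] Y := (ContinuousMultilinearMap.ofSubsingleton ℂ A Y (0 : Fin 1)).symm g
    have hD : ∀ a, g a = D (a 0) := fun a => congrArg g (funext fun i => by
      rw [Fin.fin_one_eq_zero i])
    -- The vanishing of `δg` on pairs from `I` is the derivation identity.
    obtain ⟨y, hy⟩ := I.exists_inner hI hN D (fun a ha b _ => by
      have h := hδ ![a, b] ⟨0, ha⟩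
      rw [coboundary_apply] at h
      have e1 : Fin.contractNth 0 (· * ·) ![a, b] 0 = a * b := rfl
      have e2 : Fin.init ![a, b] 0 = a := rfl
      have e3 : Fin.tail ![a, b] 0 = b := rfl
      simp only [hD, e2, e3] at h
      simp [e1] at h
      rw [← sub_eq_zero, ← neg_eq_zero, ← h]
      abel)
    refine ⟨ContinuousMultilinearMap.constOfIsEmpty ℂ _ y, ?_⟩
    rintro a ⟨i, hi⟩
    rw [Fin.fin_one_eq_zero i] at hi
    rw [sub_apply, hD, hy _ hi, coboundary_apply]
    simp [sub_eq_add_neg]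
  | succ n ih =>
    obtain ⟨h, hh⟩ := ih hN.shift (curryLast g) (by
      rw [← curryLast_coboundary]
      rintro c ⟨i, hi⟩
      ext b
      exact hδ _ ⟨i.castSucc, by rwa [Fin.snoc_castSucc]⟩)
    -- After subtracting `δ(uncurryLast h)` all arguments but the last are settled, and `δ² = 0`
    -- keeps the hypothesis on the coboundary.
    obtain ⟨T, hT⟩ := exists_vanishesOn_last hI hN
      (g := g - coboundary N (n + 1) (uncurryLast h))
      (by
        have : curryLast (g - coboundary N (n + 1) (uncurryLast h)) =
            curryLast g - coboundary N.shift n h := by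
          rw [← curryLast_uncurryLast h, ← curryLast_coboundary, curryLast_uncurryLast]
          rfl
        rwa [this])
      (by rwa [map_sub, coboundary_coboundary, sub_zero])
    exact ⟨uncurryLast h + T, by rwa [map_add, ← sub_sub]⟩

end Vanishing

/-! ### Cochains of the quotient algebra -/

section Quotient

variable {A : Type u} [NonUnitalNormedRing A] [NormedSpace ℂ A] (I : ClosedIdeal A)

/-- The operator `(A/I)* → A*`, `φ ↦ φ ∘ θ`. -/
abbrev dualProj : StrongDual ℂ I.Quot →L[ℂ] StrongDual ℂ A :=
  (ContinuousLinearMap.compL ℂ A I.Quot ℂ).flip I.proj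

/-- Every class lifts to an element of almost the same norm. The isometry later transfers continuity
from `A*`-valued to `(A/I)*`-valued cochains. -/
lemma norm_dualProj (φ : StrongDual ℂ I.Quot) : ‖dualProj I φ‖ = ‖φ‖ := by
  apply le_antisymm
  · refine ContinuousLinearMap.opNorm_le_bound _ (norm_nonneg _) fun a => ?_
    exact (φ.le_opNorm _).trans (by gcongr; exact I.norm_proj_le a)
  · refine ContinuousLinearMap.opNorm_le_bound _ (norm_nonneg _) fun x => ?_
    have key : ∀ ε > 0, ‖φ x‖ ≤ ‖dualProj I φ‖ * (‖x‖ + ε) := by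
      intro ε hε
      obtain ⟨a, rfl, ha⟩ := I.exists_proj_lt x hε
      exact ((dualProj I φ).le_opNorm a).trans (by gcongr)
    have hcont : Filter.Tendsto (fun ε : ℝ => ‖dualProj I φ‖ * (‖x‖ + ε)) (𝓝[>] 0)
        (𝓝 (‖dualProj I φ‖ * (‖x‖ + 0))) := by
      have : Continuous fun ε : ℝ => ‖dualProj I φ‖ * (‖x‖ + ε) := by fun_prop
      exact (this.tendsto 0).mono_left nhdsWithin_le_nhds
    rw [add_zero] at hcont
    exact ge_of_tendsto hcont (eventually_mem_nhdsWithin.mono key)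

lemma isometry_dualProj : Isometry (dualProj I) :=
  AddMonoidHomClass.isometry_of_norm _ (norm_dualProj I)

lemma pullback_injective (n : ℕ) : Function.Injective (pullback I.proj (dualProj I) n) := by
  intro f g h
  ext q : 1
  choose s hs using I.proj_surjective
  have := DFunLike.congr_fun h fun i => s (q i)
  simp only [pullback_apply, hs] at this
  exact (isometry_dualProj I).injective this

lemma VanishesOn.congr {I : ClosedIdeal A} {Y : Type v} [NormedAddCommGroup Y] [NormedSpace ℂ Y]
    {n : ℕ} {g : Cochain A Y n} (hg : VanishesOn I g) {a b : Fin n → A}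
    (h : ∀ i, I.proj (a i) = I.proj (b i)) : g a = g b := by
  -- In the multilinear expansion every term other than `g b` has an entry `a i - b i` in `I`.
  have e : a = b + (a - b) := by abel
  rw [e]
  refine (g.toMultilinearMap.map_add_univ b (a - b)).trans ?_
  rw [Finset.sum_eq_single Finset.univ]
  · simp
  · intro s _ hs
    obtain ⟨i, hi⟩ : ∃ i, i ∉ s := by
      by_contra! H
      exact hs (Finset.eq_univ_iff_forall.2 H)
    exact hg _ ⟨i, by rw [Finset.piecewise_eq_of_notMem _ _ _ hi]; exact I.proj_eq_iff.1 (h i)⟩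
  · simp

lemma isOpenQuotientMap_proj [CompleteSpace A] : IsOpenQuotientMap I.proj :=
  ⟨I.proj_surjective, I.proj.continuous, I.proj.isOpenMap I.proj_surjective⟩

lemma exists_dualProj_eq [CompleteSpace A] (φ : StrongDual ℂ A)
    (h : ∀ x ∈ I.toSubmodule, φ x = 0) : ∃ ψ, dualProj I ψ = φ := by
  let l : A ⧸ I.toSubmodule →ₗ[ℂ] ℂ := I.toSubmodule.liftQ φ.toLinearMap h
  have hl : ∀ a, l (I.proj a) = φ a := fun a => I.toSubmodule.liftQ_apply φ.toLinearMap a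
  have hc : Continuous (fun q : I.Quot => l q) := by
    rw [(isOpenQuotientMap_proj I).isQuotientMap.continuous_iff]
    exact φ.continuous.congr fun a => (hl a).symm
  let ψ : StrongDual ℂ I.Quot :=
    { toFun := l, map_add' := l.map_add, map_smul' := l.map_smul, cont := hc }
  exact ⟨ψ, ContinuousLinearMap.ext hl⟩

/-- The descended cochain is defined through a set-theoretic section of `A → A/I`. Linearity and
continuity are checked after composing with the injective isometry `dualProj I` and lifting
arguments along the quotient map. -/
lemma VanishesOn.exists_pullback_eq [CompleteSpace A] {I : ClosedIdeal A} {n : ℕ}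
    {g : Cochain A (StrongDual ℂ A) n} (hg : VanishesOn I g)
    (hg' : ∀ a, ∀ x ∈ I.toSubmodule, g a x = 0) :
    ∃ f, pullback I.proj (dualProj I) n f = g := by
  choose ψ hψ using fun a => exists_dualProj_eq I (g a) (hg' a)
  choose s hs using I.proj_surjective
  have hinj := (isometry_dualProj I).injective
  have key : ∀ a : Fin n → A, dualProj I (ψ fun i => s (I.proj (a i))) = g a := fun a => by
    rw [hψ]
    exact hg.congr fun i => hs _
  have hup : ∀ [DecidableEq (Fin n)] (q : Fin n → I.Quot) (i : Fin n) (x : A),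
      dualProj I (ψ fun j => s (Function.update q i (I.proj x) j)) =
        g (Function.update (fun j => s (q j)) i x) := by
    intro _ q i x
    rw [← key]
    congr 2
    funext j
    by_cases hj : j = i
    · subst hj; simp
    · simp [hj, hs]
  let f : Cochain I.Quot (StrongDual ℂ I.Quot) n :=
    { toFun := fun q => ψ fun i => s (q i)
      map_update_add' := by
        intro _ q i x y
        apply hinj
        obtain ⟨x, rfl⟩ := I.proj_surjective x
        obtain ⟨y, rfl⟩ := I.proj_surjective y
        rw [← map_add, map_add (dualProj I), hup, hup, hup, g.map_update_add]
      map_update_smul' := by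
        intro _ q i c x
        apply hinj
        obtain ⟨x, rfl⟩ := I.proj_surjective x
        rw [← map_smul, map_smul (dualProj I), hup, hup, g.map_update_smul]
      cont := by
        rw [(isometry_dualProj I).isUniformInducing.isInducing.continuous_iff,
          (IsOpenQuotientMap.piMap fun _ : Fin n =>
            isOpenQuotientMap_proj I).isQuotientMap.continuous_iff]
        exact g.cont.congr fun a => (key a).symm }
  exact ⟨f, ContinuousMultilinearMap.ext key⟩

variable {I}

lemma vanishesOn_pullback {n : ℕ} (f : Cochain I.Quot (StrongDual ℂ I.Quot) n) :
    VanishesOn I (pullback I.proj (dualProj I) n f) := by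
  rintro a ⟨i, hi⟩
  have : I.proj (a i) = 0 := by
    rw [← map_zero I.proj, I.proj_eq_iff, sub_zero]
    exact hi
  rw [pullback_apply, f.map_coord_zero i this, map_zero]

variable [IsScalarTower ℂ A A] [SMulCommClass ℂ A A]

lemma pullback_coboundary_dualProj (n : ℕ) (f : Cochain I.Quot (StrongDual ℂ I.Quot) n) :
    pullback I.proj (dualProj I) (n + 1) (coboundary (Bimodule.regular I.Quot).dual n f) =
      coboundary (Bimodule.regular A).dual n (pullback I.proj (dualProj I) n f) :=
  pullback_coboundary _ _ _ _ I.proj_mul (fun a f => by ext x; simp [I.proj_mul])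
    (fun a f => by ext x; simp [I.proj_mul]) n f

lemma naturalMap_mk (n : ℕ) (f : cocycles (Bimodule.regular I.Quot).dual n)
    (g : cocycles (Bimodule.regular A).dual n)
    (h : (g : Cochain A (StrongDual ℂ A) n) - pullback I.proj (dualProj I) n f ∈
      coboundaries (Bimodule.regular A).dual n) :
    naturalMap I n (Submodule.Quotient.mk f) = Submodule.Quotient.mk g := by
  refine Eq.symm ((Submodule.Quotient.eq _).2 ?_)
  exact h

lemma naturalMap_injective_of (n : ℕ)
    (h : ∀ f ∈ cocycles (Bimodule.regular I.Quot).dual n,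
      pullback I.proj (dualProj I) n f ∈ coboundaries (Bimodule.regular A).dual n →
        f ∈ coboundaries (Bimodule.regular I.Quot).dual n) :
    Function.Injective (naturalMap I n) := by
  refine (injective_iff_map_eq_zero _).2 fun x hx => ?_
  obtain ⟨f, rfl⟩ := Submodule.Quotient.mk_surjective _ x
  refine (Submodule.Quotient.mk_eq_zero _).2 (h f f.2 ?_)
  exact (Submodule.Quotient.mk_eq_zero
    ((coboundaries (Bimodule.regular A).dual n).submoduleOf (cocycles (Bimodule.regular A).dual n))).1
    hx

lemma apply_eq_zero_of_center_eq_bot (hc : (Bimodule.regular I.Alg).dual.center = ⊥)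
    (τ : StrongDual ℂ A) (hτ : ∀ x ∈ I.toSubmodule, ∀ y ∈ I.toSubmodule, τ (x * y) = τ (y * x)) :
    ∀ x ∈ I.toSubmodule, τ x = 0 := by
  have : τ.comp I.incl ∈ (Bimodule.regular I.Alg).dual.center := fun a => by
    ext x
    exact hτ _ (I.coe_mem x) _ (I.coe_mem a)
  rw [hc, Submodule.mem_bot] at this
  exact fun x hx => DFunLike.congr_fun this ⟨x, hx⟩

lemma coboundary_zero_apply (f : Cochain A (StrongDual ℂ A) 0) (a x : A) :
    coboundary (Bimodule.regular A).dual 0 f (fun _ => a) x = f 0 (x * a) - f 0 (a * x) := by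
  rw [coboundary_apply, Subsingleton.elim (Fin.tail _) 0, Subsingleton.elim (Fin.init _) 0]
  simp [sub_eq_add_neg]

/-! ### Descent to the quotient and bijectivity of the natural map -/

variable [CompleteSpace A]

lemma VanishesOn.exists_pullback_eq_of_coboundary (hI : IsAmenable I.Alg) {n : ℕ}
    {g : Cochain A (StrongDual ℂ A) (n + 1)} (hg : VanishesOn I g)
    (hδ : VanishesOn I (coboundary (Bimodule.regular A).dual (n + 1) g)) :
    ∃ f, pullback I.proj (dualProj I) (n + 1) f = g :=
  hg.exists_pullback_eq fun a =>
    I.eq_zero_of_left hI _ fun _ hb => hg.left_apply_eq_zero hδ hb a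

lemma naturalMap_succ_surjective (hI : IsAmenable I.Alg) (n : ℕ) :
    Function.Surjective (naturalMap I (n + 1)) := by
  intro x
  obtain ⟨⟨φ, hφ⟩, rfl⟩ := Submodule.Quotient.mk_surjective _ x
  replace hφ : coboundary (Bimodule.regular A).dual (n + 1) φ = 0 := hφ
  obtain ⟨h, hh⟩ := exists_vanishesOn_sub_coboundary hI (hasPredual_dual (Bimodule.regular A)) φ
    (by rw [hφ]; exact fun _ _ => rfl)
  have h0 : coboundary (Bimodule.regular A).dual (n + 1)
      (φ - coboundary (Bimodule.regular A).dual n h) = 0 := by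
    rw [map_sub, coboundary_coboundary, hφ, sub_zero]
  obtain ⟨f, hf⟩ := hh.exists_pullback_eq_of_coboundary hI (by rw [h0]; exact fun _ _ => rfl)
  have hf0 : coboundary (Bimodule.regular I.Quot).dual (n + 1) f = 0 :=
    pullback_injective I _ (by rw [pullback_coboundary_dualProj, hf, h0, map_zero])
  exact ⟨Submodule.Quotient.mk ⟨f, hf0⟩, naturalMap_mk _ _ _ ⟨h, by simp [hf]⟩⟩

/-- If `δg` is pulled back from `A/I`, it vanishes on `I`. As `g` has positive degree, it can be
changed by a coboundary, without changing `δg`, so that it too comes from `A/I`. -/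
lemma naturalMap_add_two_injective (hI : IsAmenable I.Alg) (n : ℕ) :
    Function.Injective (naturalMap I (n + 2)) := by
  refine naturalMap_injective_of _ fun f _ hf => ?_
  obtain ⟨g, hg⟩ : pullback I.proj (dualProj I) (n + 2) f ∈
    LinearMap.range (coboundary (Bimodule.regular A).dual (n + 1)) := hf
  have hv := hg ▸ vanishesOn_pullback f
  obtain ⟨h, hh⟩ := exists_vanishesOn_sub_coboundary hI (hasPredual_dual (Bimodule.regular A)) g hv
  have hδ : coboundary (Bimodule.regular A).dual (n + 1)
      (g - coboundary (Bimodule.regular A).dual n h) = pullback I.proj (dualProj I) (n + 2) f := by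
    rw [map_sub, coboundary_coboundary, hg, sub_zero]
  obtain ⟨k, hk⟩ := hh.exists_pullback_eq_of_coboundary hI (hδ ▸ vanishesOn_pullback f)
  exact ⟨k, pullback_injective I _ (by rw [pullback_coboundary_dualProj, hk, hδ])⟩

/-- In degree 0 vanishing on `I` is an empty condition, and the trace hypothesis supplies what
`left_apply_eq_zero` gives in positive degree. -/
lemma exists_pullback_eq_of_center_eq_bot (hc : (Bimodule.regular I.Alg).dual.center = ⊥)
    (f : Cochain A (StrongDual ℂ A) 0)
    (hf : VanishesOn I (coboundary (Bimodule.regular A).dual 0 f)) :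
    ∃ g, pullback I.proj (dualProj I) 0 g = f := by
  refine VanishesOn.exists_pullback_eq (fun a ⟨i, _⟩ => i.elim0) fun a => ?_
  rw [Subsingleton.elim a 0]
  refine apply_eq_zero_of_center_eq_bot hc _ fun x _ y hy => sub_eq_zero.1 ?_
  rw [← coboundary_zero_apply, hf (fun _ => y) ⟨0, hy⟩]
  rfl

lemma naturalMap_zero_bijective (hc : (Bimodule.regular I.Alg).dual.center = ⊥) :
    Function.Bijective (naturalMap I 0) := by
  constructor
  · refine naturalMap_injective_of _ fun f _ hf => ?_
    replace hf : pullback I.proj (dualProj I) 0 f = 0 := hf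
    exact pullback_injective I 0 (by rw [hf, map_zero])
  · intro x
    obtain ⟨⟨φ, hφ⟩, rfl⟩ := Submodule.Quotient.mk_surjective _ x
    replace hφ : coboundary (Bimodule.regular A).dual 0 φ = 0 := hφ
    obtain ⟨f, hf⟩ := exists_pullback_eq_of_center_eq_bot hc φ (by rw [hφ]; exact fun _ _ => rfl)
    have hf0 : coboundary (Bimodule.regular I.Quot).dual 0 f = 0 :=
      pullback_injective I _ (by rw [pullback_coboundary_dualProj, hf, hφ, map_zero])
    exact ⟨Submodule.Quotient.mk ⟨f, hf0⟩, naturalMap_mk _ _ _ (by simp [hf])⟩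

lemma naturalMap_one_injective (hc : (Bimodule.regular I.Alg).dual.center = ⊥) :
    Function.Injective (naturalMap I 1) := by
  refine naturalMap_injective_of _ fun f _ hf => ?_
  obtain ⟨g, hg⟩ : pullback I.proj (dualProj I) 1 f ∈
    LinearMap.range (coboundary (Bimodule.regular A).dual 0) := hf
  obtain ⟨k, hk⟩ := exists_pullback_eq_of_center_eq_bot hc g (hg ▸ vanishesOn_pullback f)
  exact ⟨k, pullback_injective I _ (by rw [pullback_coboundary_dualProj, hk, hg])⟩

end Quotient

/-! ### Openness -/

section Topology

/-- `NW` need not be closed, so the quotients are only seminormed and the open mapping theorem does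
not apply to `r` directly. It applies to `(v, b) ↦ p v + d b` from `V × B` onto `W`, where `d` has
range `NW`; openness then passes to `r`. -/
lemma exists_continuousLinearEquiv_of_bijective {V W B : Type*}
    [NormedAddCommGroup V] [NormedSpace ℂ V] [CompleteSpace V]
    [NormedAddCommGroup W] [NormedSpace ℂ W] [CompleteSpace W]
    [NormedAddCommGroup B] [NormedSpace ℂ B] [CompleteSpace B]
    {NV : Submodule ℂ V} {NW : Submodule ℂ W} (p : V →L[ℂ] W) (d : B →L[ℂ] W)
    (hd : ∀ w ∈ NW, ∃ b, d b = w) (hd' : ∀ b, d b ∈ NW)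
    (r : (V ⧸ NV) →ₗ[ℂ] W ⧸ NW) (hr : ∀ v, r (NV.mkQ v) = NW.mkQ (p v))
    (hbij : Function.Bijective r) : ∃ e : (V ⧸ NV) ≃L[ℂ] (W ⧸ NW), ∀ x, e x = r x := by
  have hq : IsOpenQuotientMap NV.mkQ := NV.isOpenQuotientMap_mkQ
  have hq' : IsOpenQuotientMap NW.mkQ := NW.isOpenQuotientMap_mkQ
  have hcont : Continuous r := by
    rw [hq.isQuotientMap.continuous_iff]
    exact (hq'.continuous.comp p.continuous).congr fun v => (hr v).symm
  have hsurj : Function.Surjective (p.coprod d) := fun w => by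
    obtain ⟨x, hx⟩ := hbij.2 (NW.mkQ w)
    obtain ⟨v, rfl⟩ := NV.mkQ_surjective x
    rw [hr] at hx
    have hw : w - p v ∈ NW := (Submodule.Quotient.eq NW).1 hx.symm
    obtain ⟨b, hb⟩ := hd _ hw
    exact ⟨(v, b), by simp [hb]⟩
  have hopen : IsOpenMap r := fun U hU => by
    have : r '' U =
        NW.mkQ '' (p.coprod d '' ((fun x : V × B => NV.mkQ x.1) ⁻¹' U)) := by
      ext y
      constructor
      · rintro ⟨x, hx, rfl⟩
        obtain ⟨v, rfl⟩ := NV.mkQ_surjective x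
        exact ⟨p v, ⟨(v, 0), hx, by simp⟩, (hr v).symm⟩
      · rintro ⟨_, ⟨⟨v, b⟩, hx, rfl⟩, rfl⟩
        refine ⟨NV.mkQ v, hx, (hr v).trans (Eq.symm ((Submodule.Quotient.eq NW).2 ?_))⟩
        simpa using hd' b
    rw [this]
    exact hq'.isOpenMap _ ((p.coprod d).isOpenMap hsurj _
      (hU.preimage (hq.continuous.comp continuous_fst)))
  let e := LinearEquiv.ofBijective _ hbij
  exact ⟨{ e with
    continuous_toFun := hcont
    continuous_invFun := (e.toEquiv.toHomeomorphOfContinuousOpen hcont hopen).symm.continuous },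
    fun _ => rfl⟩

variable {A : Type u} [NonUnitalNormedRing A] [NormedSpace ℂ A]

/-- Closed graph theorem: evaluations are continuous and separate cochains. -/
lemma continuous_of_continuous_apply {X : Type v} [NormedAddCommGroup X] [NormedSpace ℂ X]
    [CompleteSpace X] {E : Type w} [NormedAddCommGroup E] [NormedSpace ℂ E] [CompleteSpace E]
    {n : ℕ} (L : E →ₗ[ℂ] Cochain A X n) (h : ∀ a, Continuous fun x => L x a) : Continuous L := by
  refine L.continuous_of_seq_closed_graph fun u x y hu hy => ?_
  ext a
  have h1 := ((h a).tendsto x).comp hu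
  have h2 := ((ContinuousMultilinearMap.apply ℂ (fun _ : Fin n => A) X a).continuous.tendsto y).comp
    hy
  exact tendsto_nhds_unique h2 h1

variable [IsScalarTower ℂ A A] [SMulCommClass ℂ A A]
  {X : Type v} [NormedAddCommGroup X] [NormedSpace ℂ X] [CompleteSpace X]

lemma continuous_coboundary (M : Bimodule A X) (n : ℕ) : Continuous (coboundary M n) := by
  have ev : ∀ a, Continuous fun f : Cochain A X n => f a := fun a =>
    (ContinuousMultilinearMap.apply ℂ (fun _ : Fin n => A) X a).continuous
  refine continuous_of_continuous_apply _ fun a => ?_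
  simp only [coboundary_apply]
  exact (((M.left _).continuous.comp (ev _)).add
    (continuous_finsetSum _ fun i _ => (ev _).const_smul _)).add
      (((M.right _).continuous.comp (ev _)).const_smul _)

instance (M : Bimodule A X) (n : ℕ) : CompleteSpace (cocycles M n) :=
  (isClosed_singleton.preimage (continuous_coboundary M n)).completeSpace_coe

end Topology

/-! ### The natural map as a homeomorphism -/

section Topology

variable {A : Type u} [NonUnitalNormedRing A] [NormedSpace ℂ A]
  [IsScalarTower ℂ A A] [SMulCommClass ℂ A A]

/-- Coboundaries are the image of a Banach space: the cochains one degree lower, or the zero space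
in degree 0. -/
lemma exists_range_eq_coboundaries {X : Type u} [NormedAddCommGroup X] [NormedSpace ℂ X]
    [CompleteSpace X] (M : Bimodule A X) (n : ℕ) :
    ∃ (B : Type u) (_ : NormedAddCommGroup B) (_ : NormedSpace ℂ B) (_ : CompleteSpace B)
      (d : B →L[ℂ] cocycles M n),
      (∀ w ∈ (coboundaries M n).submoduleOf (cocycles M n), ∃ b, d b = w) ∧
      ∀ b, d b ∈ (coboundaries M n).submoduleOf (cocycles M n) := by
  cases n with
  | zero =>
    refine ⟨PUnit, inferInstance, inferInstance, inferInstance, 0,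
      fun w hw => ⟨0, ?_⟩, fun b => Submodule.zero_mem _⟩
    exact (Subtype.ext (show (w : Cochain A X 0) = 0 from hw)).symm
  | succ n =>
    let d : Cochain A X n →L[ℂ] Cochain A X (n + 1) := ⟨coboundary M n, continuous_coboundary M n⟩
    refine ⟨Cochain A X n, inferInstance, inferInstance, inferInstance,
      d.codRestrict (cocycles M (n + 1)) (coboundary_coboundary M n),
      fun w ⟨f, hf⟩ => ⟨f, Subtype.ext hf⟩, fun f => ⟨f, rfl⟩⟩

/-- The chain map which induces `naturalMap`. -/
def cocyclesMap [CompleteSpace A] (I : ClosedIdeal A) (n : ℕ) :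
    cocycles (Bimodule.regular I.Quot).dual n →L[ℂ] cocycles (Bimodule.regular A).dual n where
  toLinearMap := (pullback I.proj (dualProj I) n).restrict fun f hf => by
    change coboundary _ _ _ = 0
    rw [← pullback_coboundary_dualProj, show coboundary _ _ f = 0 from hf, map_zero]
  cont := by
    have hp : Continuous (pullback I.proj (dualProj I) n) :=
      continuous_of_continuous_apply _ fun a => (dualProj I).continuous.comp
        (ContinuousMultilinearMap.apply ℂ (fun _ : Fin n => I.Quot) _ _).continuous
    exact (hp.comp continuous_subtype_val).subtype_mk _

lemma exists_equiv_naturalMap_of_range [CompleteSpace A] (I : ClosedIdeal A) (n : ℕ)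
    (hbij : Function.Bijective (naturalMap I n)) {B : Type u} [NormedAddCommGroup B]
    [NormedSpace ℂ B] [CompleteSpace B] (d : B →L[ℂ] cocycles (Bimodule.regular A).dual n)
    (h1 : ∀ w ∈ (coboundaries (Bimodule.regular A).dual n).submoduleOf
      (cocycles (Bimodule.regular A).dual n), ∃ b, d b = w)
    (h2 : ∀ b, d b ∈ (coboundaries (Bimodule.regular A).dual n).submoduleOf
      (cocycles (Bimodule.regular A).dual n)) :
    ∃ e : SimplicialCohomology I.Quot n ≃L[ℂ] SimplicialCohomology A n,
      ∀ x, e x = naturalMap I n x := by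
  have := exists_continuousLinearEquiv_of_bijective (B := B)
    (V := cocycles (Bimodule.regular I.Quot).dual n) (W := cocycles (Bimodule.regular A).dual n)
    (NV := (coboundaries (Bimodule.regular I.Quot).dual n).submoduleOf
      (cocycles (Bimodule.regular I.Quot).dual n))
    (NW := (coboundaries (Bimodule.regular A).dual n).submoduleOf
      (cocycles (Bimodule.regular A).dual n))
    (cocyclesMap I n) d h1 h2
  exact this (naturalMap I n) (fun _ => rfl) hbij

lemma exists_equiv_naturalMap [CompleteSpace A] (I : ClosedIdeal A) (n : ℕ)
    (hbij : Function.Bijective (naturalMap I n)) :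
    ∃ e : SimplicialCohomology I.Quot n ≃L[ℂ] SimplicialCohomology A n,
      ∀ x, e x = naturalMap I n x := by
  obtain ⟨B, _, _, _, d, h1, h2⟩ := exists_range_eq_coboundaries (Bimodule.regular A).dual n
  exact exists_equiv_naturalMap_of_range I n hbij d h1 h2

end Topology

end BanachCohomology

end

/-! ### Assembling the degrees -/

theorem theorem2p4 {A : Type*} [NonUnitalNormedRing A] [NormedSpace ℂ A]
    [IsScalarTower ℂ A A] [SMulCommClass ℂ A A] [CompleteSpace A]
    (I : BanachCohomology.ClosedIdeal A) (hI : BanachCohomology.IsAmenable I.Alg) :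
    ((∀ n : ℕ, 2 ≤ n →
        ∃ e : BanachCohomology.SimplicialCohomology I.Quot n ≃L[ℂ]
            BanachCohomology.SimplicialCohomology A n,
          ∀ x, e x = BanachCohomology.naturalMap I n x) ∧
      Function.Surjective (BanachCohomology.naturalMap I 1)) ∧
    ((BanachCohomology.Bimodule.regular I.Alg).dual.center = ⊥ →
      ∀ n : ℕ,
        ∃ e : BanachCohomology.SimplicialCohomology I.Quot n ≃L[ℂ]
            BanachCohomology.SimplicialCohomology A n,
          ∀ x, e x = BanachCohomology.naturalMap I n x) := by
  have equiv := BanachCohomology.exists_equiv_naturalMap I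
  have add_two : ∀ n, Function.Bijective (BanachCohomology.naturalMap I (n + 2)) := fun n =>
    ⟨BanachCohomology.naturalMap_add_two_injective hI n,
      BanachCohomology.naturalMap_succ_surjective hI (n + 1)⟩
  refine ⟨⟨fun n hn => ?_, BanachCohomology.naturalMap_succ_surjective hI 0⟩, fun hc n => ?_⟩
  · obtain ⟨n, rfl⟩ := Nat.exists_eq_add_of_le' hn
    exact equiv _ (add_two n)
  · match n with
    | 0 => exact equiv 0 (BanachCohomology.naturalMap_zero_bijective hc)
    | 1 => exact equiv 1 ⟨BanachCohomology.naturalMap_one_injective hc,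
        BanachCohomology.naturalMap_succ_surjective hI 0⟩
    | n + 2 => exact equiv _ (add_two n)
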